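/- **Conventions.** All data are $C^\infty$. A Pfaffian system of rank $k$ on an open set $U\subset\mathbb R^n$ is a vector sub-bundle $S\subset T^*U$ of rank $k$. Its derived system $S_1$ consists at each point $x$ of the values $\omega_x$ of the local sections $\omega$ of $S$ with $d\omega_x\equiv 0 \bmod S_x$ (i.e. $d\omega_x$ vanishes on pairs of vectors annihilated by $S_x$); put $S_0=S$, $S_{\nu+1}=(S_\nu)_1$. $S$ is a flag system of rank $r$ and length $\ell$ if $S_\nu$ is a Pfaffian system of rank $r-\nu$ for all $\nu\le\ell$ and $S_{\ell+1}=S_\ell$; it terminates in $0$ if $r=\ell$. The germs of $S$ at $p$ and of $S'$ at $q$ are equivalent if there is a diffeomorphism $\varphi$ from a neighborhood of $p$ onto a neighborhood of $q$ with $\varphi(p)=q$ and $\varphi^*(S'_{\varphi(x)})=S_x$ for all $x$ near $p$. "Locally equivalent", for two systems on $\mathbb R^n$, means that their germs at the origin are equivalent. **Pseudo-models.** A code is a word $a_3a_4\cdots a_\ell$ in the letters $1$, $\mathbf 2$, $3$, each letter $a_\nu=\mathbf 2$ being given together with a non-zero real constant $c^{\nu+2}$. Its pseudo-model is the Pfaffian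 system on $\mathbb R^{\ell+2}$, with coordinates $x^1,\dots,x^{\ell+2}$, generated by $$\omega^1=dx^2+x^3dx^1,\qquad \omega^2=dx^3+x^4dx^1,\qquad \omega^\nu=dx^{i_\nu}+X^{\nu+2}dx^{j_\nu}\quad(3\le\nu\le\ell),$$ where $j_2=1$ and - $(i_\nu,j_\nu)=(\nu+1,j_{\nu-1})$, $X^{\nu+2}=x^{\nu+2}$ if $a_\nu=1$; - $(i_\nu,j_\nu)=(\nu+1,j_{\nu-1})$, $X^{\nu+2}=x^{\nu+2}+c^{\nu+2}$ if $a_\nu=\mathbf 2$; - $(i_\nu,j_\nu)=(j_{\nu-1},\nu+1)$, $X^{\nu+2}=x^{\nu+2}$ if $a_\nu=3$. **Theorem.** 1. Let $c^6\neq0$ and $c^9>0>\bar c^9$. The pseudo-models $(3.\mathbf 2.3.3.\mathbf 2.)$ on $\mathbb R^9$ with constants $(c^6,c^9)$ and $(c^6,\bar c^9)$ are not locally equivalent: $(3.\mathbf 2.3.3.\mathbf 2.)\not\simeq(3.\mathbf 2.3.3.\mathbf 2-.)$. Moreover, the germs of the elementary model $(3.1.3.3.1.)$ on $\mathbb R^9$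 at the points $(0,0,0,0,0,1,0,0,1)$ and $(0,0,0,0,0,1,0,0,-1)$ are not equivalent. 2. Let $c^6,c^8,c^{10},\bar c^{10}$ be non-zero with $c^{10}\ne\bar c^{10}$. The pseudo-models $(3.\mathbf 2.3.\mathbf 2.3.\mathbf 2.)$ on $\mathbb R^{10}$ with constants $(c^6,c^8,c^{10})$ and $(c^6,c^8,\bar c^{10})$ are not locally equivalent. 3. Let $c^9,c^{10},c^{11},\bar c^{11}$ be non-zero with $c^{11}\ne\bar c^{11}$. The pseudo-models $(1.3.1.1.\mathbf 2.\mathbf 2.\mathbf 2.)$ on $\mathbb R^{11}$ with constants $(c^9,c^{10},c^{11})$ and $(c^9,c^{10},\bar c^{11})$ are not locally equivalent. 4. There are uncountably many non-equivalent flag systems: for $\ell=8$ and for $\ell=9$ there is an uncountable set of flag systems of length $\ell$ on $\mathbb R^{\ell+2}$, terminating in $0$, whose members are pairwise not locally equivalent. -/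

import Mathlib

open Set Filter Topology
open scoped ContDiff

/-- The coordinate space `ℝⁿ`; the coordinate `xⁱ`, `1 ≤ i ≤ n`, is the entry with index `i - 1`. -/
abbrev Space (n : ℕ) : Type := Fin n → ℝ

/-- Covectors on `ℝⁿ`. -/
abbrev Covector (n : ℕ) : Type := Space n →L[ℝ] ℝ

/-- Differential forms of degree one on `ℝⁿ` (no regularity built in). -/
abbrev OneForm (n : ℕ) : Type := Space n → Covector n

/-- A field of subspaces of the cotangent spaces of `ℝⁿ`. -/
abbrev CovectorField (n : ℕ) : Type := Space n → Submodule ℝ (Covector n)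

/-- The value `dθ(u, v)` at `x` of the exterior derivative of a one-form. -/
noncomputable def dOne {n : ℕ} (θ : OneForm n) (x u v : Space n) : ℝ :=
  fderiv ℝ θ x u v - fderiv ℝ θ x v u

/-- `dOne` is Mathlib's exterior derivative, in degree one. -/
theorem dOne_eq_extDeriv {n : ℕ} (θ : OneForm n) (x : Space n) (hθ : DifferentiableAt ℝ θ x)
    (u v : Space n) :
    dOne θ x u v =
      extDeriv (fun y => ContinuousAlternatingMap.ofSubsingleton ℝ (Space n) ℝ (0 : Fin 1) (θ y))
        x ![u, v] := by
  let e : Covector n ≃ₗᵢ[ℝ] (Space n [⋀^Fin 1]→L[ℝ] ℝ) :=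
    ContinuousAlternatingMap.ofSubsingletonLIE (𝕜 := ℝ) (E := Space n) (F := ℝ) (ι := Fin 1) 0
  have h : fderiv ℝ (fun y => ContinuousAlternatingMap.ofSubsingleton ℝ (Space n) ℝ (0 : Fin 1)
      (θ y)) x = (e.toContinuousLinearEquiv : Covector n →L[ℝ] _).comp (fderiv ℝ θ x) :=
    (e.toContinuousLinearEquiv.hasFDerivAt.comp x hθ.hasFDerivAt).fderiv
  rw [extDeriv, h]
  simp [dOne, e, ContinuousAlternatingMap.alternatizeUncurryFin_apply, Fin.sum_univ_two,
    sub_eq_add_neg, ContinuousAlternatingMap.ofSubsingletonLIE, Fin.removeNth]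

/-- `S` is a smooth Pfaffian system of rank `k` on the open set `U`: a `C^∞` sub-bundle of rank `k`
of the cotangent bundle, given by local frames of smooth one-forms. -/
def IsPfaffianSystem {n : ℕ} (U : Set (Space n)) (k : ℕ) (S : CovectorField n) : Prop :=
  ∀ p ∈ U, ∃ θ : Fin k → OneForm n, ∀ᶠ x in 𝓝 p,
    (∀ i, ContDiffAt ℝ ∞ (θ i) x) ∧ LinearIndependent ℝ (fun i => θ i x) ∧
      S x = Submodule.span ℝ (range fun i => θ i x)

/-- `θ` is, near `x`, a smooth local section of `S`. -/
def IsSectionNear {n : ℕ} (S : CovectorField n) (x : Space n) (θ : OneForm n) : Prop :=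
  ∀ᶠ y in 𝓝 x, ContDiffAt ℝ ∞ θ y ∧ θ y ∈ S y

/-- The derived system: the kernel, at each point, of the structure tensor
`S → ⋀²T* / (S ∧ T*)`, `θ ↦ dθ mod S`. That `dθ` is zero at `x` modulo the ideal generated by `S`
means that it vanishes on all pairs of vectors annihilated by `S x`. -/
def derivedSystem {n : ℕ} (S : CovectorField n) : CovectorField n := fun x =>
  { carrier := {α | ∃ θ : OneForm n, IsSectionNear S x θ ∧ θ x = α ∧
      ∀ u v : Space n, (∀ β ∈ S x, β u = 0) → (∀ β ∈ S x, β v = 0) → dOne θ x u v = 0}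
    zero_mem' := ⟨fun _ => 0,
      Eventually.of_forall fun y => ⟨contDiffAt_const, (S y).zero_mem⟩, rfl,
      fun u v _ _ => by simp [dOne]⟩
    add_mem' := by
      rintro a b ⟨θ, hθ, rfl, hθ'⟩ ⟨η, hη, rfl, hη'⟩
      refine ⟨fun y => θ y + η y, ?_, rfl, fun u v hu hv => ?_⟩
      · filter_upwards [hθ, hη] with y h1 h2
        exact ⟨h1.1.add h2.1, (S y).add_mem h1.2 h2.2⟩
      · have d1 : DifferentiableAt ℝ θ x := hθ.self_of_nhds.1.differentiableAt (by simp)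
        have d2 : DifferentiableAt ℝ η x := hη.self_of_nhds.1.differentiableAt (by simp)
        have h1 := hθ' u v hu hv
        have h2 := hη' u v hu hv
        simp only [dOne] at h1 h2 ⊢
        rw [fderiv_fun_add d1 d2]
        simp only [add_apply]
        linarith
    smul_mem' := by
      rintro c a ⟨θ, hθ, rfl, hθ'⟩
      refine ⟨fun y => c • θ y, ?_, rfl, fun u v hu hv => ?_⟩
      · filter_upwards [hθ] with y h1
        exact ⟨h1.1.const_smul c, (S y).smul_mem c h1.2⟩
      · have d1 : DifferentiableAt ℝ θ x := hθ.self_of_nhds.1.differentiableAt (by simp)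
        have h1 := hθ' u v hu hv
        simp only [dOne] at h1 ⊢
        rw [fderiv_fun_const_smul d1]
        simp only [smul_apply, smul_eq_mul]
        rw [← mul_sub, h1, mul_zero] }

/-- `S` is a flag system of rank `r` and length `ℓ` on the open set `U`: its successive derived
systems `S_ν` are Pfaffian systems of rank `r - ν` for `ν ≤ ℓ`, and `S_ℓ` is integrable. It
terminates in `0` exactly when `r = ℓ`. -/
def IsFlagSystem {n : ℕ} (U : Set (Space n)) (r ℓ : ℕ) (S : CovectorField n) : Prop :=
  ℓ ≤ r ∧ (∀ ν ≤ ℓ, IsPfaffianSystem U (r - ν) (derivedSystem^[ν] S)) ∧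
    ∀ x ∈ U, derivedSystem^[ℓ + 1] S x = derivedSystem^[ℓ] S x

/-- The germ of `S` at `p` is equivalent to the germ of `S'` at `q`: there is a local `C^∞`
diffeomorphism `φ` around `p` with `φ(p) = q` and `φ^*(S'_{φ(x)}) = S_x` for all `x` in its
domain. -/
def LocallyEquivalentAt {n : ℕ} (S : CovectorField n) (p : Space n)
    (S' : CovectorField n) (q : Space n) : Prop :=
  ∃ φ : OpenPartialHomeomorph (Space n) (Space n), p ∈ φ.source ∧ φ p = q ∧
    ContDiffOn ℝ ∞ φ φ.source ∧ ContDiffOn ℝ ∞ φ.symm φ.target ∧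
    ∀ x ∈ φ.source, ∀ α : Covector n,
      α ∈ S x ↔ ∃ β ∈ S' (φ x), α = β.comp (fderiv ℝ φ x)

/-- The letters of the codes of pseudo-normal forms; the letter `2` carries its constant, which
should be non-zero. -/
inductive Tag : Type
  | one : Tag
  | two (c : ℝ) : Tag
  | three : Tag

/-- The coordinate `xⁱ`, `1 ≤ i ≤ n`. -/
def coord {n : ℕ} [NeZero n] (i : ℕ) (x : Space n) : ℝ := x (Fin.ofNat n (i - 1))

/-- The coordinate differential `dxⁱ`, `1 ≤ i ≤ n`. -/
def dcoord (n : ℕ) [NeZero n] (i : ℕ) : Covector n :=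
  ContinuousLinearMap.proj (Fin.ofNat n (i - 1))

/-- The forms `θ^ν, θ^{ν+1}, …` of the pseudo-normal form whose remaining code is the given list,
where `j = j_{ν-1}`:
letter `1`: `(i_ν, j_ν) = (ν+1, j_{ν-1})` and `X^{ν+2} = x^{ν+2}`;
letter `2` with constant `c`: `(i_ν, j_ν) = (ν+1, j_{ν-1})` and `X^{ν+2} = x^{ν+2} + c`;
letter `3`: `(i_ν, j_ν) = (j_{ν-1}, ν+1)` and `X^{ν+2} = x^{ν+2}`;
and `θ^ν = dx^{i_ν} + X^{ν+2} dx^{j_ν}`. -/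
noncomputable def tailForms (n : ℕ) [NeZero n] : List Tag → ℕ → ℕ → List (OneForm n)
  | [], _, _ => []
  | Tag.one :: L, ν, j =>
      (fun x => dcoord n (ν + 1) + coord (ν + 2) x • dcoord n j) :: tailForms n L (ν + 1) j
  | Tag.two c :: L, ν, j =>
      (fun x => dcoord n (ν + 1) + (coord (ν + 2) x + c) • dcoord n j) :: tailForms n L (ν + 1) j
  | Tag.three :: L, ν, j =>
      (fun x => dcoord n j + coord (ν + 2) x • dcoord n (ν + 1)) :: tailForms n L (ν + 1) (ν + 1)

/-- The pseudo-normal form with a given code. The code starts with the letter of `θ³`, after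
`θ¹ = dx² + x³ dx¹` and `θ² = dx³ + x⁴ dx¹`; a code with `m` letters gives `ℓ = m + 2` forms
on `ℝ^{ℓ+2}`. -/
noncomputable def pseudoNormalForm (L : List Tag) : List (OneForm (L.length + 4)) :=
  (fun x => dcoord _ 2 + coord 3 x • dcoord _ 1) ::
  (fun x => dcoord _ 3 + coord 4 x • dcoord _ 1) :: tailForms (L.length + 4) L 3 1

/-- The pseudo-model: the Pfaffian system on `ℝ^{ℓ+2}` generated by a pseudo-normal form. -/
noncomputable def pseudoModel (L : List Tag) : CovectorField (L.length + 4) := fun x =>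
  Submodule.span ℝ {α | ∃ θ ∈ pseudoNormalForm L, α = θ x}

/-! Letters are counted from 0, the first two being the letters 1 of ω¹ and ω². The common kernel of
the first m forms of a code is spanned by one field Z_m (`legField`) and the ∂_i with i ≥ m+2. The
only bracket that leaves the kernel of the first m+1 forms is [∂_{m+3}, Z_{m+1}], so their derived
system is spanned by the first m forms (`derivedSystem_flagSystem_succ`), and pseudo-models are flag
systems terminating in 0. A local equivalence φ preserves all these systems and their Cauchy
characteristics, spanned by the ∂_i with i > k, for k ≥ 3 (`Transforms.firstZero`). So φ_* is
triangular: φ_* Z_m ≡ f_m Z_m modulo the ∂_i, i ≥ m+2, and φ_* ∂_k ≡ g_k ∂_k modulo later ∂_i for k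
> 3.

Write X_m for the coefficient of the letter m in the source and X'_m for that of the target at the
image point. Comparing components of φ_* Z_{m+1}, for m ≥ 2, gives for a letter 3 the relation X_m
f_m = f_{m+1} X'_m and, where X_m = 0, f_{m+1} = g_{m+2} and f_m = f_{m+1} g_{m+3}. For other
letters f_{m+1} = f_m and g_{m+2} = f_{m+1} g_{m+3}. If m is a letter 3 with X_m = 0 and m+1 is
another letter, then X_{m+1} g_{m+3} = f_{m+1} X'_{m+1}; a non-zero constant common to both systems
then forces g_{m+3} = f_{m+1}. For 3.2.3.3.2 these relations combine to X_6 = f_4² X'_6, so the sign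
survives; for 3.2.3.2.3.2 the factors at the end are all 1 and the constant itself survives.

In 1.3.1.1.2.2.2 the constants are not next to the letter 3, and one expands along W = Z_9. There W
X_m = -X_{m+1} for 3 ≤ m ≤ 7, so X_3 vanishes to order 3 at the base point. In the first four
coordinates W is -X_3 Z_3, hence functions of these coordinates are nearly constant along W, and so
are f_3 and f_9. Thus X'_3∘φ is κ X_3 up to order 6, and each derivative along W divides the ratio
by c = f_9(p). The ratios at the last three letters are κ/c³, κ/c⁴, κ/c⁵; if the first two are 1,
then c = 1 and the third is 1. -/

/-- Whether a letter is the letter `3`. -/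
def Tag.IsThree : Tag → Prop
  | .three => True
  | _ => False

/-- The constant carried by a letter. -/
def Tag.const : Tag → ℝ
  | .two c => c
  | _ => 0

instance : DecidablePred Tag.IsThree := fun t => by
  cases t <;> simp only [Tag.IsThree] <;> infer_instance

/-! ### Kernels of the forms of a code -/

section Basic

variable {n : ℕ} [NeZero n]

/-- The coordinate vector `∂ᵢ`, `1 ≤ i ≤ n`. -/
def basisVec (n : ℕ) [NeZero n] (i : ℕ) : Space n := Pi.single (Fin.ofNat n (i - 1)) 1

theorem dcoord_basisVec {i j : ℕ} (hi : 1 ≤ i) (hin : i ≤ n) (hj : 1 ≤ j) (hjn : j ≤ n) :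
    dcoord n i (basisVec n j) = if i = j then 1 else 0 := by
  have : (Fin.ofNat n (i - 1) = Fin.ofNat n (j - 1)) ↔ i = j := by
    rw [Fin.ext_iff, Fin.val_ofNat, Fin.val_ofNat, Nat.mod_eq_of_lt (by omega),
      Nat.mod_eq_of_lt (by omega)]
    omega
  simp only [dcoord, basisVec, ContinuousLinearMap.proj_apply, Pi.single_apply, this]

/-- The index `j_m` of the independent variable after `m` letters. -/
def pivot (a : ℕ → Tag) : ℕ → ℕ
  | 0 => 1
  | m + 1 => if (a m).IsThree then m + 2 else pivot a m

/-- The coefficient function `X^{m+3}` of the form with letter `a m`. -/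
def legSlope (a : ℕ → Tag) (m : ℕ) (x : Space n) : ℝ := coord (m + 3) x + (a m).const

/-- The field that spans, together with the coordinate fields `∂ᵢ`, `i ≥ m + 2`, the kernel of the
first `m` forms of the code `a`. -/
noncomputable def legField (a : ℕ → Tag) : ℕ → Space n → Space n
  | 0, _ => basisVec n 1
  | m + 1, x => if (a m).IsThree then basisVec n (m + 2) - legSlope a m x • legField a m x
      else legField a m x - legSlope a m x • basisVec n (m + 2)

/-- The form with letter `a m`. -/
noncomputable def codeForm (a : ℕ → Tag) (m : ℕ) : OneForm n := fun x =>
  if (a m).IsThree then dcoord n (pivot a m) + legSlope a m x • dcoord n (m + 2)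
  else dcoord n (m + 2) + legSlope a m x • dcoord n (pivot a m)

theorem one_le_pivot (a : ℕ → Tag) (m : ℕ) : 1 ≤ pivot a m := by
  induction m with
  | zero => simp [pivot]
  | succ m ih => rw [pivot]; split_ifs <;> omega

theorem pivot_le (a : ℕ → Tag) (m : ℕ) : pivot a m ≤ m + 1 := by
  induction m with
  | zero => simp [pivot]
  | succ m ih => rw [pivot]; split_ifs <;> omega

theorem legField_succ_three {a : ℕ → Tag} {m : ℕ} (h : (a m).IsThree) (x : Space n) :
    legField a (m + 1) x = basisVec n (m + 2) - legSlope a m x • legField a m x := by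
  rw [legField, if_pos h]

theorem legField_succ_of_not {a : ℕ → Tag} {m : ℕ} (h : ¬ (a m).IsThree) (x : Space n) :
    legField a (m + 1) x = legField a m x - legSlope a m x • basisVec n (m + 2) := by
  rw [legField, if_neg h]

theorem dcoord_legField_of_lt (a : ℕ → Tag) {m i : ℕ} (x : Space n) (hi : m + 1 < i)
    (hin : i ≤ n) : dcoord n i (legField a m x) = 0 := by
  induction m with
  | zero =>
    rw [legField, dcoord_basisVec (by omega) hin (by omega) (by omega), if_neg (by omega)]
  | succ m ih =>
    have h1 := ih (by omega)
    have h2 : dcoord n i (basisVec n (m + 2)) = 0 := by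
      rw [dcoord_basisVec (by omega) hin (by omega) (by omega), if_neg (by omega)]
    rw [legField]
    split_ifs <;> simp [h1, h2]

theorem dcoord_basisVec_of_ne {i j : ℕ} (hi : 1 ≤ i) (hin : i ≤ n) (hj : 1 ≤ j) (hjn : j ≤ n)
    (h : i ≠ j) : dcoord n i (basisVec n j) = 0 := by
  rw [dcoord_basisVec hi hin hj hjn, if_neg h]

theorem dcoord_basisVec_self {i : ℕ} (hi : 1 ≤ i) (hin : i ≤ n) :
    dcoord n i (basisVec n i) = 1 := by
  rw [dcoord_basisVec hi hin hi hin, if_pos rfl]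

theorem dcoord_pivot_legField (a : ℕ → Tag) {m : ℕ} (x : Space n) (hm : m + 1 ≤ n) :
    dcoord n (pivot a m) (legField a m x) = 1 := by
  induction m with
  | zero => exact dcoord_basisVec_self le_rfl hm
  | succ m ih =>
    have h1 := ih (by omega)
    rw [legField, pivot]
    split_ifs
    · rw [map_sub, map_smul, dcoord_legField_of_lt a x (by omega) (by omega),
        dcoord_basisVec_self (by omega) (by omega)]
      simp
    · have := pivot_le a m
      rw [map_sub, map_smul, h1, dcoord_basisVec_of_ne (one_le_pivot a m) (by omega) (by omega)
        (by omega) (by omega)]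
      simp

/-- The first `k` coordinates of `v` vanish. -/
def FirstZero (k : ℕ) (v : Space n) : Prop := ∀ i, 1 ≤ i → i ≤ k → dcoord n i v = 0

theorem FirstZero.mono {k l : ℕ} {v : Space n} (h : FirstZero l v) (hkl : k ≤ l) :
    FirstZero k v := fun i h1 h2 => h i h1 (h2.trans hkl)

theorem firstZero_basisVec {k j : ℕ} (hj : k < j) (hjn : j ≤ n) :
    FirstZero k (basisVec n j) := fun i h1 h2 =>
  dcoord_basisVec_of_ne h1 (by omega) (by omega) hjn (by omega)

/-- The kernel of the first `m` forms of the code `a`. -/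
def InKernel (a : ℕ → Tag) (m : ℕ) (x u : Space n) : Prop :=
  ∃ c : ℝ, FirstZero (m + 1) (u - c • legField a m x)

theorem inKernel_legField (a : ℕ → Tag) (m : ℕ) (x : Space n) :
    InKernel a m x (legField a m x) := ⟨1, fun i _ _ => by simp⟩

theorem FirstZero.inKernel {m : ℕ} {u : Space n} (h : FirstZero (m + 1) u) (a : ℕ → Tag)
    (x : Space n) : InKernel a m x u := ⟨0, by simpa using h⟩

/-- The form with letter `a m` involves only dx^{m+2} and the differential of the pivot coordinate.
As Z_m has pivot component 1 and x^{m+2}-component 0, the new equation just ties the coefficient of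
∂_{m+2} to that of Z_m. -/
theorem inKernel_succ {a : ℕ → Tag} {m : ℕ} {x u : Space n} (hm : m + 2 ≤ n) :
    InKernel a (m + 1) x u ↔ InKernel a m x u ∧ codeForm a m x u = 0 := by
  have hp1 := one_le_pivot a m
  have hp2 := pivot_le a m
  have hp : dcoord n (pivot a m) (legField a m x) = 1 := dcoord_pivot_legField a x (by omega)
  have hz : dcoord n (m + 2) (legField a m x) = 0 := dcoord_legField_of_lt a x (by omega) hm
  have he : dcoord n (m + 2) (basisVec n (m + 2)) = 1 := dcoord_basisVec_self (by omega) hm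
  have hi0 : ∀ i, 1 ≤ i → i ≤ m + 1 → dcoord n i (basisVec n (m + 2)) = 0 := fun i h1 h2 =>
    dcoord_basisVec_of_ne h1 (by omega) (by omega) hm (by omega)
  by_cases h : (a m).IsThree
  · simp only [InKernel, FirstZero, legField_succ_three h, codeForm, if_pos h]
    constructor
    · rintro ⟨c, hc⟩
      have h0 := hc (m + 2) (by omega) le_rfl
      simp only [map_sub, map_smul, smul_eq_mul, he, hz] at h0
      refine ⟨⟨- c * legSlope a m x, fun i h1 h2 => ?_⟩, ?_⟩
      · have := hc i h1 (by omega)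
        simp only [map_sub, map_smul, smul_eq_mul, hi0 i h1 h2] at this ⊢
        linarith
      · have := hc (pivot a m) hp1 (by omega)
        simp only [map_sub, map_smul, smul_eq_mul, hi0 _ hp1 hp2, hp] at this
        simp only [add_apply, smul_apply, smul_eq_mul]
        have h3 : dcoord n (m + 2) u = c := by linarith
        rw [h3]
        linarith
    · rintro ⟨⟨c, hc⟩, h0⟩
      simp only [add_apply, smul_apply, smul_eq_mul] at h0
      have hcp := hc (pivot a m) hp1 hp2
      simp only [map_sub, map_smul, smul_eq_mul, hp] at hcp
      refine ⟨dcoord n (m + 2) u, fun i h1 h2 => ?_⟩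
      rcases Nat.lt_or_ge (m + 1) i with h3 | h3
      · obtain rfl : i = m + 2 := by omega
        simp [he, hz]
      · have := hc i h1 h3
        simp only [map_sub, map_smul, smul_eq_mul, hi0 i h1 h3] at this ⊢
        have h4 : c = - legSlope a m x * dcoord n (m + 2) u := by linarith
        rw [h4] at this
        linarith
  · simp only [InKernel, FirstZero, legField_succ_of_not h, codeForm, if_neg h]
    constructor
    · rintro ⟨c, hc⟩
      have h0 := hc (m + 2) (by omega) le_rfl
      simp only [map_sub, map_smul, smul_eq_mul, he, hz] at h0
      refine ⟨⟨c, fun i h1 h2 => ?_⟩, ?_⟩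
      · have := hc i h1 (by omega)
        simp only [map_sub, map_smul, smul_eq_mul, hi0 i h1 h2] at this ⊢
        linarith
      · have := hc (pivot a m) hp1 (by omega)
        simp only [map_sub, map_smul, smul_eq_mul, hi0 _ hp1 hp2, hp] at this
        simp only [add_apply, smul_apply, smul_eq_mul]
        have h3 : dcoord n (pivot a m) u = c := by linarith
        rw [h3]
        linarith
    · rintro ⟨⟨c, hc⟩, h0⟩
      simp only [add_apply, smul_apply, smul_eq_mul] at h0
      have hcp := hc (pivot a m) hp1 hp2
      simp only [map_sub, map_smul, smul_eq_mul, hp] at hcp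
      refine ⟨c, fun i h1 h2 => ?_⟩
      rcases Nat.lt_or_ge (m + 1) i with h3 | h3
      · obtain rfl : i = m + 2 := by omega
        simp only [map_sub, map_smul, smul_eq_mul, he, hz]
        have h4 : dcoord n (pivot a m) u = c := by linarith
        rw [h4] at h0
        linarith
      · have := hc i h1 h3
        simp only [map_sub, map_smul, smul_eq_mul, hi0 i h1 h3] at this ⊢
        linarith

theorem inKernel_zero (a : ℕ → Tag) (x u : Space n) : InKernel a 0 x u := by
  refine ⟨dcoord n 1 u, fun i h1 h2 => ?_⟩
  obtain rfl : i = 1 := by omega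
  have : dcoord n 1 (basisVec n 1) = 1 :=
    dcoord_basisVec_self le_rfl (Nat.one_le_iff_ne_zero.2 (NeZero.ne n))
  simp [legField, this]

/-- The bracket `-∂_{m+3} Z_{m+1}`, which enlarges the kernel of the first `m + 1` forms to the kernel
of the first `m`. -/
noncomputable def cornerField (a : ℕ → Tag) (m : ℕ) (x : Space n) : Space n :=
  if (a m).IsThree then legField a m x else basisVec n (m + 2)

theorem codeForm_cornerField (a : ℕ → Tag) {m : ℕ} (x : Space n) (hm : m + 2 ≤ n) :
    codeForm a m x (cornerField a m x) = 1 := by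
  have hp1 := one_le_pivot a m
  have hp2 := pivot_le a m
  have hp : dcoord n (pivot a m) (legField a m x) = 1 := dcoord_pivot_legField a x (by omega)
  have hz : dcoord n (m + 2) (legField a m x) = 0 := dcoord_legField_of_lt a x (by omega) hm
  have he : dcoord n (m + 2) (basisVec n (m + 2)) = 1 := dcoord_basisVec_self (by omega) hm
  have hi0 : dcoord n (pivot a m) (basisVec n (m + 2)) = 0 :=
    dcoord_basisVec_of_ne hp1 (by omega) (by omega) hm (by omega)
  unfold codeForm cornerField
  split_ifs <;> simp [hp, hz, he, hi0]

theorem inKernel_cornerField (a : ℕ → Tag) {m : ℕ} (x : Space n) (hm : m + 2 ≤ n) :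
    InKernel a m x (cornerField a m x) := by
  unfold cornerField
  split_ifs
  · exact inKernel_legField a m x
  · exact (firstZero_basisVec (by omega) hm).inKernel a x

theorem InKernel.sub {a : ℕ → Tag} {m : ℕ} {x u v : Space n} (hu : InKernel a m x u)
    (hv : InKernel a m x v) : InKernel a m x (u - v) := by
  obtain ⟨c, hc⟩ := hu
  obtain ⟨d, hd⟩ := hv
  refine ⟨c - d, fun i h1 h2 => ?_⟩
  have h3 := hc i h1 h2
  have h4 := hd i h1 h2
  simp only [map_sub, map_smul, smul_eq_mul] at h3 h4 ⊢
  linarith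

theorem InKernel.smul {a : ℕ → Tag} {m : ℕ} {x u : Space n} (t : ℝ) (hu : InKernel a m x u) :
    InKernel a m x (t • u) := by
  obtain ⟨c, hc⟩ := hu
  refine ⟨t * c, fun i h1 h2 => ?_⟩
  have h3 := hc i h1 h2
  simp only [map_sub, map_smul, smul_eq_mul] at h3 ⊢
  linear_combination t * h3

/-- The system generated by the first `m` forms of the code `a`. -/
def flagSystem (a : ℕ → Tag) (m : ℕ) : CovectorField n := fun x =>
  Submodule.span ℝ {α | ∃ i < m, α = codeForm a i x}

theorem codeForm_mem_flagSystem (a : ℕ → Tag) {m i : ℕ} (hi : i < m) (x : Space n) :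
    codeForm a i x ∈ flagSystem a m x := Submodule.subset_span ⟨i, hi, rfl⟩

theorem flagSystem_mono (a : ℕ → Tag) {k m : ℕ} (h : k ≤ m) (x : Space n) :
    flagSystem a k x ≤ flagSystem a m x :=
  Submodule.span_mono fun _ ⟨i, hi, hα⟩ => ⟨i, hi.trans_le h, hα⟩

/-- The corner field is dual to the last form: subtracting the multiple `α (cornerField a m x)` of
that form leaves a covector that kills the whole kernel of the first m forms, and induction applies.
-/
theorem mem_flagSystem_iff {a : ℕ → Tag} {m : ℕ} {x : Space n} (hm : m + 1 ≤ n)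
    {α : Covector n} : α ∈ flagSystem a m x ↔ ∀ u, InKernel a m x u → α u = 0 := by
  induction m generalizing α with
  | zero =>
    constructor
    · intro h u _
      have : α = 0 := by simpa [flagSystem] using h
      simp [this]
    · intro h
      have : α = 0 := by
        ext u
        simpa using h u (inKernel_zero a x u)
      rw [this]
      exact Submodule.zero_mem _
  | succ m ih =>
    constructor
    · intro h u hu
      induction h using Submodule.span_induction with
      | mem α hα =>
        obtain ⟨i, hi, rfl⟩ := hα
        have h2 := (inKernel_succ hm).1 hu
        rcases Nat.lt_succ_iff_lt_or_eq.1 hi with h3 | rfl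
        · exact (ih (by omega)).1 (codeForm_mem_flagSystem a h3 x) u h2.1
        · exact h2.2
      | zero => rfl
      | add α β _ _ h1 h2 => simp [h1, h2]
      | smul c α _ h1 => simp [h1]
    · intro h
      have key : α - α (cornerField a m x) • codeForm a m x ∈ flagSystem a m x := by
        refine (ih (by omega)).2 fun u hu => ?_
        have h1 := h (u - codeForm a m x u • cornerField a m x) ((inKernel_succ hm).2
          ⟨hu.sub ((inKernel_cornerField a x hm).smul _), by
            simp [codeForm_cornerField a x hm]⟩)
        simp only [map_sub, map_smul, smul_eq_mul, sub_apply, smul_apply] at h1 ⊢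
        linarith
      have := Submodule.add_mem _ (flagSystem_mono a m.le_succ x key)
        (Submodule.smul_mem _ (α (cornerField a m x))
          (codeForm_mem_flagSystem a m.lt_succ_self x))
      simpa using this

theorem forall_flagSystem_iff {a : ℕ → Tag} {m : ℕ} {x u : Space n} (hm : m + 1 ≤ n) :
    (∀ β ∈ flagSystem a m x, β u = 0) ↔ InKernel a m x u := by
  refine ⟨fun h => ?_, fun h β hβ => (mem_flagSystem_iff hm).1 hβ u h⟩
  induction m with
  | zero => exact inKernel_zero a x u
  | succ m ih =>
    exact (inKernel_succ hm).2 ⟨ih (by omega) fun β hβ => h β (flagSystem_mono a m.le_succ x hβ),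
      h _ (codeForm_mem_flagSystem a m.lt_succ_self x)⟩

theorem hasFDerivAt_legSlope (a : ℕ → Tag) (m : ℕ) (x : Space n) :
    HasFDerivAt (legSlope a m : Space n → ℝ) (dcoord n (m + 3)) x :=
  ((dcoord n (m + 3)).hasFDerivAt).add_const _

theorem contDiff_legSlope (a : ℕ → Tag) (m : ℕ) : ContDiff ℝ ∞ (legSlope a m : Space n → ℝ) :=
  (dcoord n (m + 3)).contDiff.add contDiff_const

theorem contDiff_legField (a : ℕ → Tag) (m : ℕ) :
    ContDiff ℝ ∞ (legField a m : Space n → Space n) := by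
  induction m with
  | zero => exact contDiff_const
  | succ m ih =>
    by_cases h : (a m).IsThree
    · rw [funext (legField_succ_three (a := a) h)]
      exact contDiff_const.sub ((contDiff_legSlope a m).smul ih)
    · rw [funext (legField_succ_of_not (a := a) h)]
      exact ih.sub ((contDiff_legSlope a m).smul contDiff_const)

theorem differentiable_legField (a : ℕ → Tag) (m : ℕ) :
    Differentiable ℝ (legField a m : Space n → Space n) :=
  (contDiff_legField a m).differentiable (by simp)

theorem contDiff_codeForm (a : ℕ → Tag) (m : ℕ) : ContDiff ℝ ∞ (codeForm a m : OneForm n) := by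
  unfold codeForm
  split_ifs
  · exact contDiff_const.add ((contDiff_legSlope a m).smul contDiff_const)
  · exact contDiff_const.add ((contDiff_legSlope a m).smul contDiff_const)

/-- The coefficients of Z_m involve only the coordinates up to x^{m+2}. -/
theorem fderiv_legField_of_firstZero (a : ℕ → Tag) {m : ℕ} (x : Space n) {v : Space n}
    (hv : FirstZero (m + 2) v) : fderiv ℝ (legField a m) x v = 0 := by
  induction m with
  | zero =>
    have : (legField a 0 : Space n → Space n) = fun _ => basisVec n 1 := rfl
    simp [this]
  | succ m ih =>
    have h1 := ih (hv.mono (by omega))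
    have h2 := hv (m + 3) (by omega) le_rfl
    have hd := (differentiable_legField a m x).hasFDerivAt
    by_cases h : (a m).IsThree
    · rw [funext (legField_succ_three (a := a) h)]
      rw [((hasFDerivAt_const _ x).fun_sub ((hasFDerivAt_legSlope a m x).fun_smul hd)).fderiv]
      simp [h1, h2]
    · rw [funext (legField_succ_of_not (a := a) h)]
      rw [(hd.fun_sub ((hasFDerivAt_legSlope a m x).fun_smul (hasFDerivAt_const _ x))).fderiv]
      simp [h1, h2]

theorem fderiv_legField_succ (a : ℕ → Tag) {m : ℕ} (x : Space n) {v : Space n}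
    (hv : FirstZero (m + 2) v) :
    fderiv ℝ (legField a (m + 1)) x v = - dcoord n (m + 3) v • cornerField a m x := by
  have h1 := fderiv_legField_of_firstZero a x hv
  have hd := (differentiable_legField a m x).hasFDerivAt
  unfold cornerField
  by_cases h : (a m).IsThree
  · rw [funext (legField_succ_three (a := a) h), if_pos h]
    rw [((hasFDerivAt_const _ x).fun_sub ((hasFDerivAt_legSlope a m x).fun_smul hd)).fderiv]
    simp [h1]
  · rw [funext (legField_succ_of_not (a := a) h), if_neg h]
    rw [(hd.fun_sub ((hasFDerivAt_legSlope a m x).fun_smul (hasFDerivAt_const _ x))).fderiv]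
    simp [h1]

end Basic

/-! ### Derived systems and characteristics -/

section Derived

variable {n : ℕ}

/-- `dθ(V, W) = -θ([V, W])` for vector fields annihilated by `θ`. -/
theorem dOne_of_annihilates {θ : OneForm n} {V W : Space n → Space n} {x : Space n}
    (hθ : DifferentiableAt ℝ θ x) (hV : DifferentiableAt ℝ V x) (hW : DifferentiableAt ℝ W x)
    (h1 : ∀ᶠ y in 𝓝 x, θ y (V y) = 0) (h2 : ∀ᶠ y in 𝓝 x, θ y (W y) = 0) :
    dOne θ x (V x) (W x) = θ x (fderiv ℝ V x (W x)) - θ x (fderiv ℝ W x (V x)) := by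
  have key : ∀ {X : Space n → Space n}, DifferentiableAt ℝ X x →
      (∀ᶠ y in 𝓝 x, θ y (X y) = 0) → ∀ v, fderiv ℝ θ x v (X x) = - θ x (fderiv ℝ X x v) := by
    intro X hX h v
    have h3 : (fun y => θ y (X y)) =ᶠ[𝓝 x] fun _ => 0 := h
    have h4 := (hθ.hasFDerivAt.clm_apply hX.hasFDerivAt).fderiv
    rw [h3.fderiv_eq] at h4
    have h5 := DFunLike.congr_fun h4 v
    simp at h5
    linarith
  rw [dOne, key hW h2, key hV h1]
  ring

/-- `φ` pulls `S'` back into `S` on `U`. -/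
def PullsBack (φ : Space n → Space n) (U : Set (Space n)) (S S' : CovectorField n) : Prop :=
  ∀ y ∈ U, ∀ β ∈ S' (φ y), β.comp (fderiv ℝ φ y) ∈ S y

/-- The terms with the second derivative of φ cancel by its symmetry. -/
theorem dOne_pullback {θ : OneForm n} {φ : Space n → Space n} {x : Space n}
    (hθ : DifferentiableAt ℝ θ (φ x)) (hφ : ContDiffAt ℝ ∞ φ x) (u v : Space n) :
    dOne (fun y => (θ (φ y)).comp (fderiv ℝ φ y)) x u v =
      dOne θ (φ x) (fderiv ℝ φ x u) (fderiv ℝ φ x v) := by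
  have h1 : DifferentiableAt ℝ φ x := hφ.differentiableAt (by simp)
  have h2 : DifferentiableAt ℝ (fderiv ℝ φ) x :=
    (hφ.fderiv_right (m := ∞) (by simp)).differentiableAt (by simp)
  have h3 := ((hθ.hasFDerivAt.comp x h1.hasFDerivAt).clm_comp h2.hasFDerivAt).fderiv
  have hs : IsSymmSndFDerivAt ℝ φ x := hφ.isSymmSndFDerivAt
    (by simpa using WithTop.coe_le_coe.2 (le_top : (2 : ℕ∞) ≤ ⊤))
  simp only [Function.comp_def] at h3
  simp only [dOne, h3]
  simp [hs.eq u v]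

theorem IsSectionNear.pullback {S S' : CovectorField n} {φ : Space n → Space n}
    {U : Set (Space n)} (hU : IsOpen U) (hφ : ContDiffOn ℝ ∞ φ U) (h : PullsBack φ U S S')
    {x : Space n} (hx : x ∈ U) {θ : OneForm n} (hθ : IsSectionNear S' (φ x) θ) :
    IsSectionNear S x fun y => (θ (φ y)).comp (fderiv ℝ φ y) := by
  have h1 : ContDiffAt ℝ ∞ φ x := hφ.contDiffAt (hU.mem_nhds hx)
  filter_upwards [h1.continuousAt.eventually hθ, hU.mem_nhds hx] with y h2 h3
  have h4 : ContDiffAt ℝ ∞ φ y := hφ.contDiffAt (hU.mem_nhds h3)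
  exact ⟨(h2.1.comp y h4).clm_comp (h4.fderiv_right (by simp)), h y h3 _ h2.2⟩

/-- The exterior derivative commutes with pullback, and Dφ carries vectors annihilated by S to
vectors annihilated by S'. -/
theorem PullsBack.derivedSystem {S S' : CovectorField n} {φ : Space n → Space n}
    {U : Set (Space n)} (hU : IsOpen U) (hφ : ContDiffOn ℝ ∞ φ U) (h : PullsBack φ U S S') :
    PullsBack φ U (derivedSystem S) (derivedSystem S') := by
  rintro x hx _ ⟨θ, hθ, rfl, hd⟩
  have h1 : ContDiffAt ℝ ∞ φ x := hφ.contDiffAt (hU.mem_nhds hx)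
  refine ⟨_, hθ.pullback hU hφ h hx, rfl, fun u v hu hv => ?_⟩
  rw [dOne_pullback (hθ.self_of_nhds.1.differentiableAt (by simp)) h1]
  exact hd _ _ (fun β hβ => hu _ (h x hx β hβ)) (fun β hβ => hv _ (h x hx β hβ))

theorem PullsBack.derivedSystem_iterate {S S' : CovectorField n} {φ : Space n → Space n}
    {U : Set (Space n)} (hU : IsOpen U) (hφ : ContDiffOn ℝ ∞ φ U) (h : PullsBack φ U S S')
    (k : ℕ) : PullsBack φ U (_root_.derivedSystem^[k] S) (_root_.derivedSystem^[k] S') := by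
  induction k with
  | zero => exact h
  | succ k ih =>
    rw [Function.iterate_succ_apply', Function.iterate_succ_apply']
    exact ih.derivedSystem hU hφ

variable [NeZero n]

/-- Each vector extends to a field tangent to the kernel, a constant multiple of Z_{m+1} plus a
constant vector. In the bracket of two such fields only the derivative of Z_{m+1} in the direction
∂_{m+3} survives, and that is minus the corner field. -/
theorem dOne_section {a : ℕ → Tag} {m : ℕ} {x : Space n} {θ : OneForm n} (hm : m + 3 ≤ n)
    (hθ : IsSectionNear (flagSystem a (m + 1)) x θ) {u v : Space n} {c d : ℝ}
    (hu : FirstZero (m + 2) (u - c • legField a (m + 1) x))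
    (hv : FirstZero (m + 2) (v - d • legField a (m + 1) x)) :
    dOne θ x u v = (d * dcoord n (m + 3) u - c * dcoord n (m + 3) v) *
      θ x (cornerField a m x) := by
  set Z : Space n → Space n := legField a (m + 1) with hZ
  have hz : dcoord n (m + 3) (Z x) = 0 := dcoord_legField_of_lt a x (by omega) hm
  have hZd : Differentiable ℝ Z := differentiable_legField a (m + 1)
  have hann : ∀ {w : Space n} (t : ℝ), FirstZero (m + 2) (w - t • Z x) →
      ∀ᶠ y in 𝓝 x, θ y (t • Z y + (w - t • Z x)) = 0 := by
    intro w t hw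
    filter_upwards [hθ] with y hy
    refine (mem_flagSystem_iff (by omega)).1 hy.2 _ ⟨t, ?_⟩
    rwa [← hZ, add_sub_cancel_left]
  have hder : ∀ (w : Space n) (t : ℝ), HasFDerivAt (fun y => t • Z y + (w - t • Z x))
      (t • fderiv ℝ Z x) x := fun w t =>
    ((hZd x).hasFDerivAt.const_smul t).add_const _
  have h := dOne_of_annihilates (hθ.self_of_nhds.1.differentiableAt (by simp))
    (hder u c).differentiableAt (hder v d).differentiableAt (hann c hu) (hann d hv)
  rw [(hder u c).fderiv, (hder v d).fderiv] at h
  have hsplit : ∀ {w : Space n} {t : ℝ}, FirstZero (m + 2) (w - t • Z x) →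
      fderiv ℝ Z x w = t • fderiv ℝ Z x (Z x) - dcoord n (m + 3) w • cornerField a m x := by
    intro w t hw
    have h1 := fderiv_legField_succ a x hw
    rw [← hZ, map_sub, map_smul, map_sub, map_smul, hz] at h1
    rw [sub_eq_iff_eq_add.1 h1]
    simp [sub_eq_neg_add]
  simp only [add_sub_cancel, smul_apply, hsplit hu, hsplit hv, map_smul, map_sub,
    smul_eq_mul] at h
  rw [h]
  ring

theorem isSectionNear_codeForm (a : ℕ → Tag) {m i : ℕ} (hi : i < m) (x : Space n) :
    IsSectionNear (flagSystem a m) x (codeForm a i) :=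
  Eventually.of_forall fun y => ⟨(contDiff_codeForm a i).contDiffAt, codeForm_mem_flagSystem a hi y⟩

/-- By `dOne_section` on the pair ∂_{m+3}, Z_{m+1}, a section is in the derived system exactly when
it kills the corner field, which completes the kernel of m+1 forms to that of m forms. -/
theorem derivedSystem_flagSystem_succ (a : ℕ → Tag) {m : ℕ} (hm : m + 3 ≤ n) :
    derivedSystem (flagSystem a (m + 1) : CovectorField n) = flagSystem a m := by
  funext x
  refine le_antisymm ?_ (Submodule.span_le.2 ?_)
  · rintro _ ⟨θ, hθ, rfl, hd⟩
    have he := firstZero_basisVec (k := m + 2) (j := m + 3) (by omega) hm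
    have h1 := hd (basisVec n (m + 3)) (legField a (m + 1) x)
      ((forall_flagSystem_iff (by omega)).2 (he.inKernel a x))
      ((forall_flagSystem_iff (by omega)).2 (inKernel_legField a (m + 1) x))
    rw [dOne_section hm hθ (c := 0) (d := 1) (by simpa using he) (by simp [FirstZero]),
      dcoord_basisVec_self (by omega) hm] at h1
    have h2 : θ x (cornerField a m x) = 0 := by simpa using h1
    refine (mem_flagSystem_iff (by omega)).2 fun u hu => ?_
    have h3 := (mem_flagSystem_iff (by omega)).1 hθ.self_of_nhds.2
      (u - codeForm a m x u • cornerField a m x) ((inKernel_succ (by omega)).2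
          ⟨hu.sub ((inKernel_cornerField a x (by omega)).smul _), by
            simp [codeForm_cornerField a x (show m + 2 ≤ n by omega)]⟩)
    simpa [h2] using h3
  · rintro _ ⟨i, hi, rfl⟩
    refine ⟨codeForm a i, isSectionNear_codeForm a (by omega) x, rfl, fun u v hu hv => ?_⟩
    obtain ⟨c, hc⟩ := (forall_flagSystem_iff (by omega)).1 hu
    obtain ⟨d, hd⟩ := (forall_flagSystem_iff (by omega)).1 hv
    rw [dOne_section hm (isSectionNear_codeForm a (by omega) x) hc hd,
      (mem_flagSystem_iff (by omega)).1 (codeForm_mem_flagSystem a hi x) _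
        (inKernel_cornerField a x (by omega)), mul_zero]

theorem flagSystem_zero (a : ℕ → Tag) (x : Space n) : flagSystem a 0 x = ⊥ := by
  simp [flagSystem]

theorem derivedSystem_flagSystem_zero (a : ℕ → Tag) :
    derivedSystem (flagSystem a 0 : CovectorField n) = flagSystem a 0 := by
  funext x
  refine le_antisymm ?_ (by rw [flagSystem_zero]; exact bot_le)
  rintro _ ⟨θ, hθ, rfl, -⟩
  exact hθ.self_of_nhds.2

theorem derivedSystem_iterate_flagSystem (a : ℕ → Tag) {m k : ℕ} (hk : k ≤ m) (hm : m + 2 ≤ n) :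
    derivedSystem^[k] (flagSystem a m : CovectorField n) = flagSystem a (m - k) := by
  induction k with
  | zero => rfl
  | succ k ih =>
    rw [Function.iterate_succ_apply', ih (by omega)]
    obtain ⟨j, hj⟩ : ∃ j, m - k = j + 1 := ⟨m - k - 1, by omega⟩
    rw [hj, derivedSystem_flagSystem_succ a (by omega)]
    congr 1
    omega

theorem linearIndependent_codeForm (a : ℕ → Tag) {m : ℕ} (hm : m + 1 ≤ n) (x : Space n) :
    LinearIndependent ℝ fun i : Fin m => codeForm a i x := by
  induction m with
  | zero => exact linearIndependent_empty_type
  | succ m ih =>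
    rw [linearIndependent_finSucc']
    refine ⟨ih (by omega), fun h => ?_⟩
    have h1 : codeForm a m x ∈ flagSystem a m x := by
      refine Submodule.span_mono ?_ h
      rintro _ ⟨i, rfl⟩
      exact ⟨i, i.2, rfl⟩
    have h2 := (mem_flagSystem_iff (by omega)).1 h1 _ (inKernel_cornerField a x hm)
    rw [codeForm_cornerField a x hm] at h2
    exact one_ne_zero h2

theorem isPfaffianSystem_flagSystem (a : ℕ → Tag) {m : ℕ} (hm : m + 1 ≤ n)
    (U : Set (Space n)) : IsPfaffianSystem U m (flagSystem a m) := by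
  refine fun p _ => ⟨fun i => codeForm a i, Eventually.of_forall fun x =>
    ⟨fun i => (contDiff_codeForm a i).contDiffAt, linearIndependent_codeForm a hm x, ?_⟩⟩
  refine congrArg _ (Set.ext fun α => ⟨?_, ?_⟩)
  · rintro ⟨i, hi, rfl⟩
    exact ⟨⟨i, hi⟩, rfl⟩
  · rintro ⟨i, rfl⟩
    exact ⟨i, i.2, rfl⟩

theorem isFlagSystem_flagSystem (a : ℕ → Tag) {m : ℕ} (hm : m + 2 ≤ n) (U : Set (Space n)) :
    IsFlagSystem U m m (flagSystem a m) := by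
  refine ⟨le_rfl, fun ν hν => ?_, fun x _ => ?_⟩
  · rw [derivedSystem_iterate_flagSystem a hν hm]
    exact isPfaffianSystem_flagSystem a (by omega) U
  · rw [Function.iterate_succ_apply', derivedSystem_iterate_flagSystem a le_rfl hm, Nat.sub_self,
      derivedSystem_flagSystem_zero]

/-- The letters of the code `L`, preceded by the letters of the first two forms. -/
def letters (L : List Tag) (m : ℕ) : Tag := (.one :: .one :: L).getD m .one

theorem mem_tailForms {a : ℕ → Tag} {L : List Tag} {m : ℕ} {θ : OneForm n}
    (h : ∀ k < L.length, a (m + k) = L.getD k .one) :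
    θ ∈ tailForms n L (m + 1) (pivot a m) ↔ ∃ k < L.length, θ = codeForm a (m + k) := by
  induction L generalizing m with
  | nil => simp [tailForms]
  | cons t L ih =>
    have ht : a m = t := by simpa using h 0 (by simp)
    have hL : ∀ k < L.length, a (m + 1 + k) = L.getD k .one := fun k hk => by
      simpa [add_assoc, add_comm 1 k] using h (k + 1) (by simpa using hk)
    have hcons : tailForms n (t :: L) (m + 1) (pivot a m) =
        codeForm a m :: tailForms n L (m + 1 + 1) (pivot a (m + 1)) := by
      cases t <;>
        refine congrArg₂ List.cons (funext fun x => ?_) ?_ <;>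
        simp [codeForm, pivot, ht, Tag.IsThree, legSlope, Tag.const]
    rw [hcons, List.mem_cons, ih hL]
    constructor
    · rintro (rfl | ⟨k, hk, rfl⟩)
      · exact ⟨0, by simp, rfl⟩
      · exact ⟨k + 1, by simpa using hk, by rw [add_assoc, add_comm 1 k]⟩
    · rintro ⟨k, hk, rfl⟩
      rcases k with _ | k
      · exact Or.inl rfl
      · exact Or.inr ⟨k, by simpa using hk, by rw [add_assoc, add_comm 1 k]⟩

theorem pseudoModel_eq_flagSystem (L : List Tag) :
    pseudoModel L = flagSystem (letters L) (L.length + 2) := by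
  funext x
  refine congrArg _ (Set.ext fun α => ?_)
  -- The two fixed leading forms are those of two letters 1 with pivot 1.
  have h : pseudoNormalForm L =
      tailForms (L.length + 4) (.one :: .one :: L) (0 + 1) (pivot (letters L) 0) := rfl
  simp only [h, mem_ofPred_eq]
  constructor
  · rintro ⟨θ, hθ, rfl⟩
    obtain ⟨k, hk, rfl⟩ := (mem_tailForms fun k _ => by simp [letters]).1 hθ
    exact ⟨k, hk, by rw [zero_add]⟩
  · rintro ⟨i, hi, rfl⟩
    exact ⟨codeForm (letters L) i, (mem_tailForms fun k _ => by simp [letters]).2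
      ⟨i, hi, by rw [zero_add]⟩, rfl⟩

/-- Pairing with ∂_{m+3} removes the Z_{m+1} component of u, pairing with Z_{m+1} its
x^{m+3}-component. Together with `dOne_section_of_firstZero` this describes the Cauchy
characteristics without reference to coordinates. -/
theorem firstZero_of_dOne_codeForm {a : ℕ → Tag} {m : ℕ} {x u : Space n} (hm : m + 3 ≤ n)
    (hu : InKernel a (m + 1) x u)
    (h : ∀ w, InKernel a (m + 1) x w → dOne (codeForm a m) x u w = 0) : FirstZero (m + 3) u := by
  obtain ⟨c, hc⟩ := hu
  have hs := isSectionNear_codeForm a m.lt_succ_self x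
  have he := firstZero_basisVec (k := m + 2) (j := m + 3) (by omega) hm
  have h1 := h _ (he.inKernel a x)
  rw [dOne_section hm hs hc (d := 0) (by simpa using he), dcoord_basisVec_self (by omega) hm,
    codeForm_cornerField a x (by omega)] at h1
  have hc0 : c = 0 := by linarith
  subst hc0
  have h2 := h _ (inKernel_legField a (m + 1) x)
  rw [dOne_section hm hs hc (d := 1) (by simp [FirstZero]),
    codeForm_cornerField a x (by omega)] at h2
  intro i h3 h4
  rcases Nat.lt_or_ge (m + 2) i with h5 | h5
  · obtain rfl : i = m + 3 := by omega
    linarith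
  · simpa using hc i h3 h5

theorem dOne_section_of_firstZero {a : ℕ → Tag} {m : ℕ} {x u w : Space n} {θ : OneForm n}
    (hm : m + 3 ≤ n) (hθ : IsSectionNear (flagSystem a (m + 1)) x θ) (hu : FirstZero (m + 3) u)
    (hw : InKernel a (m + 1) x w) : dOne θ x u w = 0 := by
  obtain ⟨d, hd⟩ := hw
  rw [dOne_section hm hθ (c := 0) (by simpa using hu.mono (by omega)) hd,
    hu (m + 3) (by omega) le_rfl]
  ring

end Derived

/-! ### Local equivalences and the subspaces they preserve -/

section Symmetry

variable {n : ℕ}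

/-- The local diffeomorphism `φ` transforms the system `S` into `S'`. -/
structure Transforms (φ : OpenPartialHomeomorph (Space n) (Space n)) (S S' : CovectorField n) :
    Prop where
  contDiffOn : ContDiffOn ℝ ∞ φ φ.source
  contDiffOn_symm : ContDiffOn ℝ ∞ φ.symm φ.target
  pullsBack : PullsBack φ φ.source S S'
  pullsBack_symm : PullsBack φ.symm φ.target S' S

variable {φ : OpenPartialHomeomorph (Space n) (Space n)} {S S' : CovectorField n}

theorem Transforms.symm (h : Transforms φ S S') : Transforms φ.symm S' S where
  contDiffOn := h.contDiffOn_symm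
  contDiffOn_symm := by simpa using h.contDiffOn
  pullsBack := h.pullsBack_symm
  pullsBack_symm := by simpa using h.pullsBack

theorem fderiv_fderiv_symm (h1 : ContDiffOn ℝ ∞ φ φ.source)
    (h2 : ContDiffOn ℝ ∞ φ.symm φ.target) {y : Space n} (hy : y ∈ φ.target) (v : Space n) :
    fderiv ℝ φ (φ.symm y) (fderiv ℝ φ.symm y v) = v := by
  have h3 : DifferentiableAt ℝ φ (φ.symm y) :=
    (h1.contDiffAt (φ.open_source.mem_nhds (φ.map_target hy))).differentiableAt (by simp)
  have h4 : DifferentiableAt ℝ φ.symm y :=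
    (h2.contDiffAt (φ.open_target.mem_nhds hy)).differentiableAt (by simp)
  have h5 : (φ ∘ φ.symm) =ᶠ[𝓝 y] id := by
    filter_upwards [φ.open_target.mem_nhds hy] with z hz using φ.right_inv hz
  have h6 := h5.fderiv_eq (𝕜 := ℝ)
  rw [fderiv_comp y h3 h4, fderiv_id] at h6
  exact DFunLike.congr_fun h6 v

theorem Transforms.of_forall (h1 : ContDiffOn ℝ ∞ φ φ.source)
    (h2 : ContDiffOn ℝ ∞ φ.symm φ.target)
    (h : ∀ x ∈ φ.source, ∀ α : Covector n,
      α ∈ S x ↔ ∃ β ∈ S' (φ x), α = β.comp (fderiv ℝ φ x)) : Transforms φ S S' where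
  contDiffOn := h1
  contDiffOn_symm := h2
  pullsBack := fun x hx β hβ => (h x hx _).2 ⟨β, hβ, rfl⟩
  pullsBack_symm := fun y hy α hα => by
    obtain ⟨β, hβ, rfl⟩ := (h _ (φ.map_target hy) α).1 hα
    rw [φ.right_inv hy] at hβ
    convert hβ
    ext v
    simp [fderiv_fderiv_symm h1 h2 hy]

theorem Transforms.contDiffAt (h : Transforms φ S S') {x : Space n} (hx : x ∈ φ.source) :
    ContDiffAt ℝ ∞ φ x := h.contDiffOn.contDiffAt (φ.open_source.mem_nhds hx)

variable [NeZero n] {a b : ℕ → Tag}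

/-- `φ` transforms the code system of `a` into that of `b`. -/
abbrev TransformsCode (φ : OpenPartialHomeomorph (Space n) (Space n)) (a b : ℕ → Tag) : Prop :=
  Transforms φ (flagSystem a (n - 2)) (flagSystem b (n - 2))

namespace Transforms

theorem pullsBack_flagSystem (h : TransformsCode φ a b) {m : ℕ} (hm : m + 2 ≤ n) :
    PullsBack φ φ.source (flagSystem a m) (flagSystem b m) := by
  have h1 := h.pullsBack.derivedSystem_iterate φ.open_source h.contDiffOn (n - 2 - m)
  rwa [derivedSystem_iterate_flagSystem a (by omega) (by omega),
    derivedSystem_iterate_flagSystem b (by omega) (by omega),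
    show n - 2 - (n - 2 - m) = m by omega] at h1

theorem inKernel (h : TransformsCode φ a b) {m : ℕ} (hm : m + 2 ≤ n) {x u : Space n}
    (hx : x ∈ φ.source) (hu : InKernel a m x u) : InKernel b m (φ x) (fderiv ℝ φ x u) :=
  (forall_flagSystem_iff (by omega)).1 fun β hβ =>
    (mem_flagSystem_iff (by omega)).1 (h.pullsBack_flagSystem hm x hx β hβ) u hu

/-- Cauchy characteristics are natural: the form of the target pulls back to a section of the source
system, whose exterior derivative vanishes on v paired with the kernel. The bound 3 ≤ k comes from
the characteristics of the rank-one system, spanned by the ∂_i with i > 3. -/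
theorem firstZero (h : TransformsCode φ a b) {k : ℕ} (hk : 3 ≤ k) (hkn : k ≤ n) {x v : Space n}
    (hx : x ∈ φ.source) (hv : FirstZero k v) : FirstZero k (fderiv ℝ φ x v) := by
  obtain ⟨m, rfl⟩ := Nat.exists_eq_add_of_le' hk
  refine firstZero_of_dOne_codeForm (a := b) (x := φ x) hkn
    (h.inKernel (by omega) hx ((hv.mono (by omega)).inKernel a x)) fun w hw => ?_
  have h1 := h.symm.inKernel (m := m + 1) (by omega) (φ.map_source hx) hw
  have h2 := fderiv_fderiv_symm h.contDiffOn h.contDiffOn_symm (φ.map_source hx) w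
  rw [φ.left_inv hx] at h1 h2
  have hs := isSectionNear_codeForm b m.lt_succ_self (φ x)
  rw [← h2, ← dOne_pullback (hs.self_of_nhds.1.differentiableAt (by simp)) (h.contDiffAt hx)]
  exact dOne_section_of_firstZero hkn (hs.pullback φ.open_source h.contDiffOn
    (h.pullsBack_flagSystem (by omega)) hx) hv h1

theorem firstZero_of_fderiv (h : TransformsCode φ a b) {k : ℕ} (hk : 3 ≤ k) (hkn : k ≤ n)
    {x v : Space n} (hx : x ∈ φ.source) (hv : FirstZero k (fderiv ℝ φ x v)) : FirstZero k v := by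
  have h1 := h.symm.firstZero hk hkn (φ.map_source hx) hv
  have h2 := fderiv_fderiv_symm h.symm.contDiffOn h.symm.contDiffOn_symm
    (y := x) (by simpa using hx) v
  rw [φ.symm_symm] at h2
  rwa [h2] at h1

end Transforms

/-! ### The factors of an equivalence and their relations -/

/-- The factor `f` in `φ_* Z_m ≡ f Z_m`. -/
noncomputable def factor (φ : OpenPartialHomeomorph (Space n) (Space n)) (a b : ℕ → Tag) (m : ℕ)
    (x : Space n) : ℝ := dcoord n (pivot b m) (fderiv ℝ φ x (legField a m x))

namespace Transforms

/-- Kernels are preserved, so φ_* Z_m is a multiple of Z_m modulo later ∂_i; the multiple is read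
off at the pivot, where Z_m has component 1. -/
theorem fderiv_legField (h : TransformsCode φ a b) {m : ℕ} (hm : m + 2 ≤ n) {x : Space n}
    (hx : x ∈ φ.source) {i : ℕ} (hi : 1 ≤ i) (him : i ≤ m + 1) :
    dcoord n i (fderiv ℝ φ x (legField a m x)) =
      factor φ a b m x * dcoord n i (legField b m (φ x)) := by
  obtain ⟨c, hc⟩ := h.inKernel hm hx (inKernel_legField a m x)
  have h1 := hc _ (one_le_pivot b m) (pivot_le b m)
  have h2 := hc i hi him
  rw [map_sub, map_smul, dcoord_pivot_legField b _ (by omega), ← factor] at h1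
  rw [map_sub, map_smul] at h2
  simp only [smul_eq_mul] at h1 h2
  rw [show factor φ a b m x = c by linarith]
  linarith

theorem factor_ne_zero (h : TransformsCode φ a b) {m : ℕ} (h2m : 2 ≤ m) (hm : m + 2 ≤ n)
    {x : Space n} (hx : x ∈ φ.source) : factor φ a b m x ≠ 0 := by
  intro h0
  have h1 : FirstZero (m + 1) (legField a m x) :=
    h.firstZero_of_fderiv (by omega) (by omega) hx fun i hi him => by
      rw [h.fderiv_legField hm hx hi him, h0, zero_mul]
  have h2 := h1 _ (one_le_pivot a m) (pivot_le a m)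
  rw [dcoord_pivot_legField a x (by omega)] at h2
  exact one_ne_zero h2

theorem fderiv_basisVec (h : TransformsCode φ a b) {i k : ℕ} (hk : 3 < k) (hkn : k ≤ n)
    (hi : 1 ≤ i) (hik : i < k) {x : Space n} (hx : x ∈ φ.source) :
    dcoord n i (fderiv ℝ φ x (basisVec n k)) = 0 :=
  h.firstZero (k := k - 1) (by omega) (by omega) hx (firstZero_basisVec (by omega) hkn) i hi
    (by omega)

theorem contDiffAt_fderiv_apply (h : Transforms φ S S') (i : ℕ) {V : Space n → Space n}
    (hV : ContDiff ℝ ∞ V) {x : Space n} (hx : x ∈ φ.source) :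
    ContDiffAt ℝ ∞ (fun y => dcoord n i (fderiv ℝ φ y (V y))) x :=
  (dcoord n i).contDiff.contDiffAt.comp x
    (((h.contDiffAt hx).fderiv_right (by simp)).clm_apply hV.contDiffAt)

theorem contDiffAt_factor (h : Transforms φ S S') (a b : ℕ → Tag) (m : ℕ) {x : Space n}
    (hx : x ∈ φ.source) : ContDiffAt ℝ ∞ (factor φ a b m) x :=
  h.contDiffAt_fderiv_apply _ (contDiff_legField a m) hx

/-- By symmetry D²φ(v, V) = D²φ(V, v), whose i-th component is a derivative of the identically zero
function dxⁱ(φ_* v). Only the derivative of V contributes. -/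
theorem fderiv_fderiv_apply (h : Transforms φ S S') {i : ℕ} {V : Space n → Space n}
    (hV : ContDiff ℝ ∞ V) {x v : Space n} (hx : x ∈ φ.source)
    (hv : ∀ y ∈ φ.source, dcoord n i (fderiv ℝ φ y v) = 0) :
    fderiv ℝ (fun y => dcoord n i (fderiv ℝ φ y (V y))) x v =
      dcoord n i (fderiv ℝ φ x (fderiv ℝ V x v)) := by
  have h1 : HasFDerivAt (fderiv ℝ φ) (fderiv ℝ (fderiv ℝ φ) x) x :=
    (((h.contDiffAt hx).fderiv_right (m := ∞) (by simp)).differentiableAt (by simp)).hasFDerivAt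
  have hV1 := (hV.differentiable (by simp) x).hasFDerivAt
  have hs : IsSymmSndFDerivAt ℝ φ x := (h.contDiffAt hx).isSymmSndFDerivAt
    (by simpa using WithTop.coe_le_coe.2 (le_top : (2 : ℕ∞) ≤ ⊤))
  have h2 := ((dcoord n i).hasFDerivAt.comp x (h1.clm_apply hV1)).fderiv
  have h3 : (fun y => dcoord n i (fderiv ℝ φ y v)) =ᶠ[𝓝 x] fun _ => 0 := by
    filter_upwards [φ.open_source.mem_nhds hx] with y hy using hv y hy
  have h4 := ((dcoord n i).hasFDerivAt.comp x (h1.clm_apply (hasFDerivAt_const v x))).fderiv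
  simp only [Function.comp_def] at h2 h4
  rw [h3.fderiv_eq] at h4
  have h5 := DFunLike.congr_fun h4 (V x)
  rw [h2]
  simp at h5 ⊢
  rw [← hs.eq v (V x)] at h5
  exact h5.symm

theorem hasFDerivAt_legSlope_comp (h : Transforms φ S S') (b : ℕ → Tag) (m : ℕ) {x : Space n}
    (hx : x ∈ φ.source) :
    HasFDerivAt (fun y => legSlope b m (φ y)) ((dcoord n (m + 3)).comp (fderiv ℝ φ x)) x :=
  (hasFDerivAt_legSlope b m (φ x)).comp x
    ((h.contDiffAt hx).differentiableAt (by simp)).hasFDerivAt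

variable {m : ℕ} {x : Space n}

theorem factor_succ_three (hb : (b m).IsThree) (ha : (a m).IsThree) :
    factor φ a b (m + 1) x = dcoord n (m + 2) (fderiv ℝ φ x (basisVec n (m + 2))) -
      legSlope a m x * dcoord n (m + 2) (fderiv ℝ φ x (legField a m x)) := by
  rw [factor, pivot, if_pos hb, legField_succ_three ha]
  simp

/-- This is the old pivot component of φ_* Z_{m+1}, to which φ_* ∂_{m+2} contributes nothing. -/
theorem legSlope_mul_factor (h : TransformsCode φ a b) (hb : (b m).IsThree) (ha : (a m).IsThree)
    (h2m : 2 ≤ m) (hm : m + 3 ≤ n) (hx : x ∈ φ.source) :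
    legSlope a m x * factor φ a b m x = factor φ a b (m + 1) x * legSlope b m (φ x) := by
  have hp1 := one_le_pivot b m
  have hp2 := pivot_le b m
  have h1 := h.fderiv_legField (m := m + 1) (by omega) hx hp1 (by omega)
  rw [legField_succ_three ha, legField_succ_three hb, map_sub, map_smul, map_sub, map_smul,
    map_sub, map_smul, h.fderiv_basisVec (by omega) (by omega) hp1 (by omega) hx,
    dcoord_pivot_legField b _ (by omega),
    dcoord_basisVec_of_ne hp1 (by omega) (by omega) (by omega) (by omega), ← factor] at h1
  simp only [smul_eq_mul] at h1
  linarith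

theorem factor_succ_of_not (h : TransformsCode φ a b) (hb : ¬ (b m).IsThree)
    (ha : ¬ (a m).IsThree) (h2m : 2 ≤ m) (hm : m + 3 ≤ n) (hx : x ∈ φ.source) :
    factor φ a b (m + 1) x = factor φ a b m x := by
  have hp1 := one_le_pivot b m
  have hp2 := pivot_le b m
  rw [factor, pivot, if_neg hb, legField_succ_of_not ha, map_sub, map_smul, map_sub, map_smul,
    h.fderiv_basisVec (by omega) (by omega) hp1 (by omega) hx, factor]
  simp

theorem legSlope_transform (h : TransformsCode φ a b) (hb : ¬ (b m).IsThree)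
    (ha : ¬ (a m).IsThree) (hm : m + 3 ≤ n) (hx : x ∈ φ.source) :
    dcoord n (m + 2) (fderiv ℝ φ x (legField a m x)) -
      legSlope a m x * dcoord n (m + 2) (fderiv ℝ φ x (basisVec n (m + 2))) =
      - factor φ a b (m + 1) x * legSlope b m (φ x) := by
  have h1 := h.fderiv_legField (m := m + 1) (i := m + 2) (by omega) hx (by omega) (by omega)
  rw [legField_succ_of_not ha, legField_succ_of_not hb, map_sub, map_smul, map_sub, map_smul,
    map_sub, map_smul, dcoord_legField_of_lt b _ (by omega) (by omega),
    dcoord_basisVec_self (by omega) (by omega)] at h1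
  simp only [smul_eq_mul] at h1
  linarith

/-- Derivative of `legSlope_mul_factor`: both coefficient functions vanish at the point, so no
derivative of a factor enters. -/
theorem fderiv_coord_of_three (h : TransformsCode φ a b) (hb : (b m).IsThree)
    (ha : (a m).IsThree) (h2m : 2 ≤ m) (hm : m + 3 ≤ n) (hx : x ∈ φ.source)
    (h0 : legSlope a m x = 0) (v : Space n) :
    dcoord n (m + 3) v * factor φ a b m x =
      factor φ a b (m + 1) x * dcoord n (m + 3) (fderiv ℝ φ x v) := by
  have h1 := h.legSlope_mul_factor hb ha h2m hm hx
  rw [h0, zero_mul, eq_comm, mul_eq_zero, or_iff_right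
    (h.factor_ne_zero (by omega) (by omega) hx)] at h1
  have h2 : (fun y => legSlope a m y * factor φ a b m y) =ᶠ[𝓝 x]
      fun y => factor φ a b (m + 1) y * legSlope b m (φ y) := by
    filter_upwards [φ.open_source.mem_nhds hx] with y hy
      using h.legSlope_mul_factor hb ha h2m hm hy
  have hf : ∀ k, HasFDerivAt (factor φ a b k) (fderiv ℝ (factor φ a b k) x) x := fun k =>
    ((h.contDiffAt_factor a b k hx).differentiableAt (by simp)).hasFDerivAt
  have h3 := h2.fderiv_eq (𝕜 := ℝ)
  rw [((hasFDerivAt_legSlope a m x).fun_mul (hf m)).fderiv,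
    ((hf (m + 1)).fun_mul (h.hasFDerivAt_legSlope_comp b m hx)).fderiv] at h3
  have h4 := DFunLike.congr_fun h3 v
  simp [h0, h1] at h4
  linarith

/-- Derivative of `legSlope_transform` along ∂_{m+3}: the factor is constant in that direction, and
∂_{m+3} Z_{m+1} = -∂_{m+2}. -/
theorem fderiv_basisVec_of_not (h : TransformsCode φ a b) (hb : ¬ (b m).IsThree)
    (ha : ¬ (a m).IsThree) (h2m : 2 ≤ m) (hm : m + 3 ≤ n) (hx : x ∈ φ.source) :
    dcoord n (m + 2) (fderiv ℝ φ x (basisVec n (m + 2))) =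
      factor φ a b (m + 1) x * dcoord n (m + 3) (fderiv ℝ φ x (basisVec n (m + 3))) := by
  have hp1 := one_le_pivot b m
  have hp2 := pivot_le b m
  have hv : ∀ i, 1 ≤ i → i < m + 3 → ∀ y ∈ φ.source,
      dcoord n i (fderiv ℝ φ y (basisVec n (m + 3))) = 0 := fun i hi him y hy =>
    h.fderiv_basisVec (by omega) hm hi him hy
  have hZ : fderiv ℝ (legField a (m + 1)) x (basisVec n (m + 3)) = - basisVec n (m + 2) := by
    rw [fderiv_legField_succ a x (firstZero_basisVec (by omega) hm),
      dcoord_basisVec_self (by omega) hm, cornerField, if_neg ha, neg_one_smul]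
  have h1 : (fun y => dcoord n (m + 2) (fderiv ℝ φ y (legField a (m + 1) y))) =ᶠ[𝓝 x]
      fun y => - (factor φ a b (m + 1) y * legSlope b m (φ y)) := by
    filter_upwards [φ.open_source.mem_nhds hx] with y hy
    have := h.legSlope_transform hb ha hm hy
    rw [legField_succ_of_not ha, map_sub, map_smul, map_sub, map_smul, smul_eq_mul, this]
    ring
  have hf := ((h.contDiffAt_factor a b (m + 1) hx).differentiableAt (by simp)).hasFDerivAt
  have h2 := DFunLike.congr_fun (h1.fderiv_eq (𝕜 := ℝ)) (basisVec n (m + 3))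
  have h3 : fderiv ℝ (factor φ a b (m + 1)) x (basisVec n (m + 3)) = 0 := by
    have hpb : pivot b (m + 1) = pivot b m := by rw [pivot, if_neg hb]
    have := h.fderiv_fderiv_apply (i := pivot b (m + 1)) (contDiff_legField a (m + 1)) hx
      (hv _ (one_le_pivot _ _) (by omega))
    unfold factor
    rw [this, hZ, map_neg, map_neg, hpb, h.fderiv_basisVec (by omega) (by omega) hp1 (by omega) hx,
      neg_zero]
  rw [h.fderiv_fderiv_apply (contDiff_legField a (m + 1)) hx (hv _ (by omega) (by omega)), hZ,
    (hf.fun_mul (h.hasFDerivAt_legSlope_comp b m hx)).fun_neg.fderiv] at h2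
  simp [h3] at h2
  exact h2

/-- The coordinate following a letter `3` and the constant of the next letter. -/
theorem legSlope_transform_of_three (h : TransformsCode φ a b)
    (hb : (b m).IsThree) (ha : (a m).IsThree) (hb' : ¬ (b (m + 1)).IsThree)
    (ha' : ¬ (a (m + 1)).IsThree) (h2m : 2 ≤ m) (hm : m + 4 ≤ n) (hx : x ∈ φ.source)
    (h0 : legSlope a m x = 0) :
    legSlope a (m + 1) x * dcoord n (m + 3) (fderiv ℝ φ x (basisVec n (m + 3))) =
      factor φ a b (m + 1) x * legSlope b (m + 1) (φ x) := by
  have h1 := h.legSlope_transform hb' ha' (by omega) hx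
  -- With v = ∂_{m+2} this shows that φ_* ∂_{m+2}, which is φ_* Z_{m+1} here because the coefficient
  -- of the letter 3 is zero, has no x^{m+3}-component.
  have h2 := h.fderiv_coord_of_three hb ha h2m (by omega) hx h0 (basisVec n (m + 2))
  rw [dcoord_basisVec_of_ne (by omega) (by omega) (by omega) (by omega) (by omega), zero_mul,
    eq_comm, mul_eq_zero, or_iff_right (h.factor_ne_zero (by omega) (by omega) hx)] at h2
  rw [h.factor_succ_of_not hb' ha' (by omega) (by omega) hx, legField_succ_three ha, h0, zero_smul,
    sub_zero, h2] at h1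
  linarith

end Transforms

end Symmetry

/-! ### Pointwise invariants -/

namespace Transforms

section Pointwise

variable {n : ℕ} [NeZero n] {φ : OpenPartialHomeomorph (Space n) (Space n)} {a b : ℕ → Tag}
  {m : ℕ} {x : Space n}

/-- The relations of the letter `3` at a point where its coordinate vanishes. -/
theorem factors_of_three (h : TransformsCode φ a b) (hb : (b m).IsThree) (ha : (a m).IsThree)
    (h2m : 2 ≤ m) (hm : m + 3 ≤ n) (hx : x ∈ φ.source) (h0 : legSlope a m x = 0) :
    factor φ a b (m + 1) x = dcoord n (m + 2) (fderiv ℝ φ x (basisVec n (m + 2))) ∧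
    factor φ a b m x = factor φ a b (m + 1) x *
      dcoord n (m + 3) (fderiv ℝ φ x (basisVec n (m + 3))) := by
  refine ⟨by rw [factor_succ_three hb ha, h0, zero_mul, sub_zero], ?_⟩
  have := h.fderiv_coord_of_three hb ha h2m hm hx h0 (basisVec n (m + 3))
  rwa [dcoord_basisVec_self (by omega) hm, one_mul] at this

end Pointwise

/-- For the code `3.2.3.3.2.` the sign of the last constant is invariant. -/
theorem legSlope_three_two_three_three_two
    {φ : OpenPartialHomeomorph (Space 9) (Space 9)} {a b : ℕ → Tag} {p : Space 9}
    (h : TransformsCode φ a b) (hp : p ∈ φ.source)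
    (ha2 : (a 2).IsThree) (ha3 : ¬ (a 3).IsThree) (ha4 : (a 4).IsThree) (ha5 : (a 5).IsThree)
    (ha6 : ¬ (a 6).IsThree) (hb2 : (b 2).IsThree) (hb3 : ¬ (b 3).IsThree) (hb4 : (b 4).IsThree)
    (hb5 : (b 5).IsThree) (hb6 : ¬ (b 6).IsThree)
    (h2 : legSlope a 2 p = 0) (h4 : legSlope a 4 p = 0) (h5 : legSlope a 5 p = 0)
    (h3 : legSlope a 3 p ≠ 0) (h33 : legSlope b 3 (φ p) = legSlope a 3 p) :
    legSlope a 6 p = factor φ a b 4 p ^ 2 * legSlope b 6 (φ p) := by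
  have e3 := h.factor_succ_of_not hb3 ha3 (by omega) (by omega) hp
  have s3 := h.legSlope_transform_of_three hb2 ha2 hb3 ha3 (by omega) (by omega) hp h2
  have t3 := h.fderiv_basisVec_of_not hb3 ha3 (by omega) (by omega) hp
  obtain ⟨e4, t4⟩ := h.factors_of_three hb4 ha4 (by omega) (by omega) hp h4
  obtain ⟨e5, t5⟩ := h.factors_of_three hb5 ha5 (by omega) (by omega) hp h5
  have s6 := h.legSlope_transform_of_three hb5 ha5 hb6 ha6 (by omega) (by omega) hp h5
  have n4 := h.factor_ne_zero (m := 4) (by omega) (by omega) hp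
  simp only [Nat.reduceAdd] at e3 s3 t3 e4 t4 e5 t5 s6 n4
  -- In order: g_5 = f_4, g_6 = 1, f_5 = 1, g_7 = f_4, f_6 = f_4, f_4 g_8 = 1, and X_6 g_8 = f_4
  -- X'_6.
  rw [h33, mul_comm, mul_left_inj' h3, ← e3] at s3
  rw [s3, left_eq_mul₀ n4] at t3
  rw [t3] at e4
  rw [e4, one_mul] at t4
  rw [← t4] at e5
  rw [e4, e5] at t5
  rw [e5] at s6
  linear_combination factor φ a b 4 p * s6 + legSlope a 6 p * t5

/-- For the code `3.2.3.2.3.2.` the last constant is invariant. -/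
theorem legSlope_three_two_three_two_three_two
    {φ : OpenPartialHomeomorph (Space 10) (Space 10)} {a b : ℕ → Tag} {p : Space 10}
    (h : TransformsCode φ a b) (hp : p ∈ φ.source)
    (ha2 : (a 2).IsThree) (ha3 : ¬ (a 3).IsThree) (ha4 : (a 4).IsThree) (ha5 : ¬ (a 5).IsThree)
    (ha6 : (a 6).IsThree) (ha7 : ¬ (a 7).IsThree) (hb2 : (b 2).IsThree) (hb3 : ¬ (b 3).IsThree)
    (hb4 : (b 4).IsThree) (hb5 : ¬ (b 5).IsThree) (hb6 : (b 6).IsThree) (hb7 : ¬ (b 7).IsThree)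
    (h2 : legSlope a 2 p = 0) (h4 : legSlope a 4 p = 0) (h6 : legSlope a 6 p = 0)
    (h3 : legSlope a 3 p ≠ 0) (h33 : legSlope b 3 (φ p) = legSlope a 3 p)
    (h5 : legSlope a 5 p ≠ 0) (h55 : legSlope b 5 (φ p) = legSlope a 5 p) :
    legSlope a 7 p = legSlope b 7 (φ p) := by
  have e3 := h.factor_succ_of_not hb3 ha3 (by omega) (by omega) hp
  have s3 := h.legSlope_transform_of_three hb2 ha2 hb3 ha3 (by omega) (by omega) hp h2
  have t3 := h.fderiv_basisVec_of_not hb3 ha3 (by omega) (by omega) hp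
  obtain ⟨e4, t4⟩ := h.factors_of_three hb4 ha4 (by omega) (by omega) hp h4
  have e5 := h.factor_succ_of_not hb5 ha5 (by omega) (by omega) hp
  have s5 := h.legSlope_transform_of_three hb4 ha4 hb5 ha5 (by omega) (by omega) hp h4
  have t5 := h.fderiv_basisVec_of_not hb5 ha5 (by omega) (by omega) hp
  obtain ⟨e6, t6⟩ := h.factors_of_three hb6 ha6 (by omega) (by omega) hp h6
  have s7 := h.legSlope_transform_of_three hb6 ha6 hb7 ha7 (by omega) (by omega) hp h6
  have n4 := h.factor_ne_zero (m := 4) (by omega) (by omega) hp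
  simp only [Nat.reduceAdd] at e3 s3 t3 e4 t4 e5 s5 t5 e6 t6 s7 n4
  -- As before f_5 = 1; the second common constant gives g_7 = 1, whence g_8 = f_7 = g_9 = 1.
  rw [h33, mul_comm, mul_left_inj' h3, ← e3] at s3
  rw [s3, left_eq_mul₀ n4] at t3
  rw [t3] at e4
  rw [e4] at e5
  rw [h55, mul_comm, mul_left_inj' h5, e4] at s5
  rw [s5, e5, one_mul] at t5
  rw [← t5] at e6
  rw [e5, e6, one_mul] at t6
  rw [e6, ← t6] at s7
  linarith

end Transforms

theorem exists_transformsCode {n : ℕ} [NeZero n] {a b : ℕ → Tag} {p q : Space n}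
    (h : LocallyEquivalentAt (flagSystem a (n - 2)) p (flagSystem b (n - 2)) q) :
    ∃ φ : OpenPartialHomeomorph (Space n) (Space n), TransformsCode φ a b ∧ p ∈ φ.source ∧
      φ p = q := by
  obtain ⟨φ, hp, hq, h1, h2, h3⟩ := h
  exact ⟨φ, .of_forall h1 h2 h3, hp, hq⟩

theorem not_locallyEquivalentAt_of_sign (c₆ c₉ c₉' : ℝ) (h6 : c₆ ≠ 0) (h9 : 0 < c₉)
    (h9' : c₉' < 0) : ¬ LocallyEquivalentAt
        (pseudoModel [.three, .two c₆, .three, .three, .two c₉] : CovectorField 9) 0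
        (pseudoModel [.three, .two c₆, .three, .three, .two c₉'] : CovectorField 9) 0 := by
  intro h
  simp only [pseudoModel_eq_flagSystem] at h
  obtain ⟨φ, hφ, hp, hq⟩ := exists_transformsCode (n := 9) h
  have := hφ.legSlope_three_two_three_three_two hp
    (by simp [letters, Tag.IsThree]) (by simp [letters, Tag.IsThree])
    (by simp [letters, Tag.IsThree]) (by simp [letters, Tag.IsThree])
    (by simp [letters, Tag.IsThree]) (by simp [letters, Tag.IsThree])
    (by simp [letters, Tag.IsThree]) (by simp [letters, Tag.IsThree])
    (by simp [letters, Tag.IsThree]) (by simp [letters, Tag.IsThree])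
    (by simp [letters, legSlope, coord, Tag.const]) (by simp [letters, legSlope, coord, Tag.const])
    (by simp [letters, legSlope, coord, Tag.const])
    (by simpa [letters, legSlope, coord, Tag.const] using h6)
    (by rw [hq]; simp [letters, legSlope, coord, Tag.const])
  rw [hq] at this
  simp [letters, legSlope, coord, Tag.const] at this
  nlinarith [mul_nonneg (sq_nonneg (factor φ (letters [.three, .two c₆, .three, .three, .two c₉])
    (letters [.three, .two c₆, .three, .three, .two c₉']) 4 0)) (neg_nonneg.2 h9'.le)]

/-- At these points the coefficients x⁶ = 1 and x⁹ = ±1 play the part of the constants, so the sign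
argument applies. -/
theorem not_locallyEquivalentAt_elementary : ¬ LocallyEquivalentAt
        (pseudoModel [.three, .one, .three, .three, .one] : CovectorField 9)
        ![0, 0, 0, 0, 0, 1, 0, 0, 1]
        (pseudoModel [.three, .one, .three, .three, .one] : CovectorField 9)
        ![0, 0, 0, 0, 0, 1, 0, 0, -1] := by
  intro h
  simp only [pseudoModel_eq_flagSystem] at h
  obtain ⟨φ, hφ, hp, hq⟩ := exists_transformsCode (n := 9) h
  have := hφ.legSlope_three_two_three_three_two hp
    (by simp [letters, Tag.IsThree]) (by simp [letters, Tag.IsThree])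
    (by simp [letters, Tag.IsThree]) (by simp [letters, Tag.IsThree])
    (by simp [letters, Tag.IsThree]) (by simp [letters, Tag.IsThree])
    (by simp [letters, Tag.IsThree]) (by simp [letters, Tag.IsThree])
    (by simp [letters, Tag.IsThree]) (by simp [letters, Tag.IsThree])
    (by simp [letters, legSlope, coord, Tag.const]) (by simp [letters, legSlope, coord, Tag.const])
    (by simp [letters, legSlope, coord, Tag.const])
    (by simp [letters, legSlope, coord, Tag.const])
    (by rw [hq]; simp [letters, legSlope, coord, Tag.const])
  rw [hq] at this
  simp [letters, legSlope, coord, Tag.const] at this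
  nlinarith [sq_nonneg (factor φ (letters [.three, .one, .three, .three, .one])
    (letters [.three, .one, .three, .three, .one]) 4 ![0, 0, 0, 0, 0, 1, 0, 0, 1])]

theorem not_locallyEquivalentAt_of_modulus_eight (c₆ c₈ c₁₀ c₁₀' : ℝ) (h6 : c₆ ≠ 0)
    (h8 : c₈ ≠ 0) (hne : c₁₀ ≠ c₁₀') : ¬ LocallyEquivalentAt
        (pseudoModel [.three, .two c₆, .three, .two c₈, .three, .two c₁₀] : CovectorField 10) 0
        (pseudoModel [.three, .two c₆, .three, .two c₈, .three, .two c₁₀'] : CovectorField 10)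
        0 := by
  intro h
  simp only [pseudoModel_eq_flagSystem] at h
  obtain ⟨φ, hφ, hp, hq⟩ := exists_transformsCode (n := 10) h
  have := hφ.legSlope_three_two_three_two_three_two hp
    (by simp [letters, Tag.IsThree]) (by simp [letters, Tag.IsThree])
    (by simp [letters, Tag.IsThree]) (by simp [letters, Tag.IsThree])
    (by simp [letters, Tag.IsThree]) (by simp [letters, Tag.IsThree])
    (by simp [letters, Tag.IsThree]) (by simp [letters, Tag.IsThree])
    (by simp [letters, Tag.IsThree]) (by simp [letters, Tag.IsThree])
    (by simp [letters, Tag.IsThree]) (by simp [letters, Tag.IsThree])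
    (by simp [letters, legSlope, coord, Tag.const]) (by simp [letters, legSlope, coord, Tag.const])
    (by simp [letters, legSlope, coord, Tag.const])
    (by simpa [letters, legSlope, coord, Tag.const] using h6)
    (by rw [hq]; simp [letters, legSlope, coord, Tag.const])
    (by simpa [letters, legSlope, coord, Tag.const] using h8)
    (by rw [hq]; simp [letters, legSlope, coord, Tag.const])
  rw [hq] at this
  simp [letters, legSlope, coord, Tag.const] at this
  exact hne this

/-! ### Order of vanishing along a vector field -/

section Vanishing

variable {n : ℕ}

/-- `F` is smooth at `p` and vanishes there to order `k` along the vector field `W`. -/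
def VanishesAlong (W : Space n → Space n) (p : Space n) : ℕ → (Space n → ℝ) → Prop
  | 0, F => ContDiffAt ℝ ∞ F p
  | k + 1, F => ContDiffAt ℝ ∞ F p ∧ F p = 0 ∧
      VanishesAlong W p k fun y => fderiv ℝ F y (W y)

namespace VanishesAlong

variable {W : Space n → Space n} {p : Space n} {F G : Space n → ℝ} {k j : ℕ}

theorem contDiffAt (h : VanishesAlong W p k F) : ContDiffAt ℝ ∞ F p := by
  cases k with
  | zero => exact h
  | succ k => exact h.1

theorem congr (h : VanishesAlong W p k F) (hFG : F =ᶠ[𝓝 p] G) : VanishesAlong W p k G := by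
  induction k generalizing F G with
  | zero => exact ContDiffAt.congr_of_eventuallyEq h hFG.symm
  | succ k ih =>
    refine ⟨h.1.congr_of_eventuallyEq hFG.symm, hFG.eq_of_nhds ▸ h.2.1, ih h.2.2 ?_⟩
    filter_upwards [hFG.fderiv (𝕜 := ℝ)] with y hy
    rw [hy]

theorem of_succ (h : VanishesAlong W p (k + 1) F) : VanishesAlong W p k F := by
  induction k generalizing F with
  | zero => exact h.1
  | succ k ih => exact ⟨h.1, h.2.1, ih h.2.2⟩

theorem mono (h : VanishesAlong W p k F) (hj : j ≤ k) : VanishesAlong W p j F := by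
  induction hj with
  | refl => exact h
  | step _ ih => exact ih h.of_succ

theorem eventually_differentiableAt (h : ContDiffAt ℝ ∞ F p) :
    ∀ᶠ y in 𝓝 p, DifferentiableAt ℝ F y := by
  filter_upwards [(h.of_le (m := 1) (by simp)).eventually (by simp)] with y hy
    using hy.differentiableAt (by simp)

theorem contDiffAt_fderiv (hW : ContDiff ℝ ∞ W) (h : ContDiffAt ℝ ∞ F p) :
    ContDiffAt ℝ ∞ (fun y => fderiv ℝ F y (W y)) p :=
  (h.fderiv_right (by simp)).clm_apply hW.contDiffAt

theorem add (hF : VanishesAlong W p k F) (hG : VanishesAlong W p k G) :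
    VanishesAlong W p k fun y => F y + G y := by
  induction k generalizing F G with
  | zero => exact ContDiffAt.add hF hG
  | succ k ih =>
    refine ⟨hF.1.add hG.1, by simp [hF.2.1, hG.2.1], (ih hF.2.2 hG.2.2).congr ?_⟩
    filter_upwards [eventually_differentiableAt hF.1, eventually_differentiableAt hG.1]
      with y h1 h2
    rw [fderiv_fun_add h1 h2, add_apply]

theorem eventually_fderiv_mul (hF : ContDiffAt ℝ ∞ F p) (hG : ContDiffAt ℝ ∞ G p) :
    (fun y => fderiv ℝ F y (W y) * G y + F y * fderiv ℝ G y (W y)) =ᶠ[𝓝 p]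
      fun y => fderiv ℝ (fun z => F z * G z) y (W y) := by
  filter_upwards [eventually_differentiableAt hF, eventually_differentiableAt hG] with y h1 h2
  rw [fderiv_fun_mul h1 h2]
  simp
  ring

theorem mul_contDiffAt (hW : ContDiff ℝ ∞ W) (hF : VanishesAlong W p k F)
    (hG : ContDiffAt ℝ ∞ G p) : VanishesAlong W p k fun y => F y * G y := by
  induction k generalizing F G with
  | zero => exact ContDiffAt.mul hF hG
  | succ k ih =>
    exact ⟨hF.1.mul hG, by simp [hF.2.1], ((ih hF.2.2 hG).add
      (ih hF.of_succ (contDiffAt_fderiv hW hG))).congr (eventually_fderiv_mul hF.1 hG)⟩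

/-- Leibniz rule, by double induction: each derivative lowers the order of one factor only. -/
theorem mul (hW : ContDiff ℝ ∞ W) (hF : VanishesAlong W p k F) (hG : VanishesAlong W p j G) :
    VanishesAlong W p (k + j) fun y => F y * G y := by
  induction k generalizing F G j with
  | zero =>
    rw [zero_add]
    simpa only [mul_comm] using hG.mul_contDiffAt hW hF
  | succ k ih =>
    induction j generalizing F G with
    | zero => exact hF.mul_contDiffAt hW hG
    | succ j ih' =>
      refine ⟨hF.1.mul hG.1, by simp [hF.2.1], VanishesAlong.congr (.add ?_ ?_)
        (eventually_fderiv_mul hF.1 hG.1)⟩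
      · have := ih hF.2.2 hG
        rwa [show k + (j + 1) = (k + 1).add j by simp only [Nat.add_eq]; omega] at this
      · have := ih' hF hG.2.2
        exact this

theorem const_mul (hW : ContDiff ℝ ∞ W) (c : ℝ) (hF : VanishesAlong W p k F) :
    VanishesAlong W p k fun y => c * F y := by
  simpa only [mul_comm] using hF.mul_contDiffAt hW (contDiffAt_const (c := c))

theorem of_mul (hW : ContDiff ℝ ∞ W) (h : VanishesAlong W p k fun y => G y * F y)
    (hG : ContDiffAt ℝ ∞ G p) (h0 : G p ≠ 0) : VanishesAlong W p k F := by
  refine (h.mul_contDiffAt hW (hG.inv h0)).congr ?_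
  filter_upwards [hG.continuousAt.eventually_ne h0] with y hy
  rw [Pi.inv_apply, mul_comm (G y), mul_inv_cancel_right₀ hy]

/-- A function whose derivative along `W` vanishes to order `k`, minus its value. -/
theorem sub_const_of_fderiv (hF : ContDiffAt ℝ ∞ F p)
    (h : VanishesAlong W p k fun y => fderiv ℝ F y (W y)) :
    VanishesAlong W p (k + 1) fun y => F y - F p :=
  ⟨hF.sub contDiffAt_const, sub_self _, h.congr (.of_forall fun y => by simp only [fderiv_sub_const])⟩

/-- Passage from proportional functions to their derivatives, where the parameter of the second
curve has derivative `f`, constant to order `3`. -/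
theorem proportional_fderiv {f A A' P P' : Space n → ℝ} {κ c : ℝ} (hW : ContDiff ℝ ∞ W)
    (hf : ContDiffAt ℝ ∞ f p) (hc : f p = c) (hc0 : c ≠ 0)
    (hfc : VanishesAlong W p 3 fun y => f y - c)
    (hA : ContDiffAt ℝ ∞ A p) (hP : ContDiffAt ℝ ∞ P p)
    (hAd : ∀ᶠ y in 𝓝 p, fderiv ℝ A y (W y) = - A' y)
    (hPd : ∀ᶠ y in 𝓝 p, fderiv ℝ P y (W y) = - f y * P' y)
    (h : VanishesAlong W p (k + 1) fun y => P y - κ * A y) (hA' : VanishesAlong W p j A')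
    (hkj : k ≤ 3 + j) : VanishesAlong W p k fun y => P' y - κ / c * A' y := by
  -- The identity is c f (P' - (κ/c) A') = -c W(P - κ A) - κ (f - c) A', and c f is invertible near
  -- p.
  have h1 := (h.2.2.const_mul hW (-c)).add (((hfc.mul hW hA').mono hkj).const_mul hW (-κ))
  refine of_mul hW (G := fun y => c * f y) (h1.congr ?_) (contDiffAt_const.mul hf)
    (by rw [hc]; exact mul_ne_zero hc0 hc0)
  filter_upwards [eventually_differentiableAt hA, eventually_differentiableAt hP, hAd, hPd]
    with y d1 d2 h2 h3
  rw [fderiv_fun_sub d2 (d1.const_mul κ), fderiv_const_mul d1, sub_apply, smul_apply, h2, h3]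
  field_simp
  simp only [smul_eq_mul]
  ring

end VanishesAlong

variable [NeZero n]

theorem dcoord_legField_of_le {a : ℕ → Tag} {m M : ℕ} (hmM : m ≤ M)
    (h : ∀ k, m ≤ k → k < M → ¬ (a k).IsThree) (hM : M + 1 ≤ n) (x : Space n) {i : ℕ} (hi : 1 ≤ i)
    (him : i ≤ m + 1) : dcoord n i (legField a M x) = dcoord n i (legField a m x) := by
  induction M, hmM using Nat.le_induction with
  | base => rfl
  | succ M hM' ih =>
    rw [legField_succ_of_not (h M hM' M.lt_succ_self), map_sub, map_smul,
      ih (fun k h1 h2 => h k h1 (by omega)) (by omega),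
      dcoord_basisVec_of_ne hi (by omega) (by omega) (by omega) (by omega), smul_zero, sub_zero]

/-- Without a letter 3 the leg field is never rescaled, so earlier components persist. This gives W
X_m = -X_{m+1}. -/
theorem dcoord_legField_eq_neg_legSlope {a : ℕ → Tag} {m M : ℕ} (hmM : m < M)
    (h : ∀ k, m ≤ k → k < M → ¬ (a k).IsThree) (hM : M + 1 ≤ n) (x : Space n) :
    dcoord n (m + 2) (legField a M x) = - legSlope a m x := by
  rw [dcoord_legField_of_le (m := m + 1) hmM (fun k h1 h2 => h k (by omega) h2) hM x (by omega)
    (by omega), legField_succ_of_not (h m le_rfl hmM), map_sub, map_smul,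
    dcoord_legField_of_lt a x (by omega) (by omega), dcoord_basisVec_self (by omega) (by omega)]
  simp

end Vanishing

/-! ### The modulus in length nine -/

namespace Transforms

open VanishesAlong

/-- For the code `1.3.1.1.2.2.2.` the last constant is invariant. -/
theorem legSlope_one_three_one_one_two_two_two
    {φ : OpenPartialHomeomorph (Space 11) (Space 11)} {a b : ℕ → Tag} {p : Space 11}
    (h : TransformsCode φ a b) (hp : p ∈ φ.source)
    (ha2 : ¬ (a 2).IsThree) (ha3 : (a 3).IsThree) (ha : ∀ k, 4 ≤ k → k < 9 → ¬ (a k).IsThree)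
    (hb2 : ¬ (b 2).IsThree) (hb3 : (b 3).IsThree) (hb : ∀ k, 4 ≤ k → k < 9 → ¬ (b k).IsThree)
    (hb01 : pivot b 2 = 1)
    (h3 : legSlope a 3 p = 0) (h4 : legSlope a 4 p = 0) (h5 : legSlope a 5 p = 0)
    (h6 : legSlope a 6 p ≠ 0) (h66 : legSlope b 6 (φ p) = legSlope a 6 p)
    (h7 : legSlope a 7 p ≠ 0) (h77 : legSlope b 7 (φ p) = legSlope a 7 p) :
    legSlope b 8 (φ p) = legSlope a 8 p := by
  set W : Space 11 → Space 11 := legField a 9 with hWdef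
  have hW : ContDiff ℝ ∞ W := contDiff_legField a 9
  have hU : ∀ᶠ y in 𝓝 p, y ∈ φ.source := φ.open_source.mem_nhds hp
  have hAs : ∀ m, ContDiffAt ℝ ∞ (legSlope a m : Space 11 → ℝ) p := fun m =>
    (contDiff_legSlope a m).contDiffAt
  have hPs : ∀ m, ContDiffAt ℝ ∞ (fun y => legSlope b m (φ y)) p := fun m =>
    (contDiff_legSlope b m).contDiffAt.comp p (h.contDiffAt hp)
  -- the derivatives along `W`
  have hAd : ∀ m, 3 ≤ m → m ≤ 7 → ∀ y : Space 11,
      fderiv ℝ (legSlope a m) y (W y) = - legSlope a (m + 1) y := by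
    intro m h1 h2 y
    rw [(hasFDerivAt_legSlope a m y).fderiv]
    exact dcoord_legField_eq_neg_legSlope (m := m + 1) (by omega)
      (fun k _ h4 => ha k (by omega) h4) (by omega) y
  have hPd : ∀ m, 3 ≤ m → m ≤ 7 → ∀ᶠ y in 𝓝 p,
      fderiv ℝ (fun y => legSlope b m (φ y)) y (W y) =
        - factor φ a b 9 y * legSlope b (m + 1) (φ y) := by
    intro m h1 h2
    filter_upwards [hU] with y hy
    rw [(h.hasFDerivAt_legSlope_comp b m hy).fderiv, ContinuousLinearMap.comp_apply,
      h.fderiv_legField (m := 9) (by omega) hy (by omega) (by omega),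
      dcoord_legField_eq_neg_legSlope (m := m + 1) (M := 9) (by omega)
        (fun k _ h4 => hb k (by omega) h4) (by omega)]
    ring
  have hA5 : VanishesAlong W p 1 (legSlope a 5) := ⟨hAs 5, h5, contDiffAt_fderiv hW (hAs 5)⟩
  have hA4 : VanishesAlong W p 2 (legSlope a 4) := ⟨hAs 4, h4, (hA5.const_mul hW (-1)).congr
    (.of_forall fun y => by simp [hAd 4 (by omega) (by omega)])⟩
  have hA3 : VanishesAlong W p 3 (legSlope a 3) := ⟨hAs 3, h3, (hA4.const_mul hW (-1)).congr
    (.of_forall fun y => by simp [hAd 3 (by omega) (by omega)])⟩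
  -- functions of the first four coordinates are constant to order four
  have hconst : ∀ (i : ℕ) (V : Space 11 → Space 11), ContDiff ℝ ∞ V → 1 ≤ i → i ≤ 4 →
      (∀ y v, FirstZero 4 v → fderiv ℝ V y v = 0) → VanishesAlong W p 3 fun y =>
        dcoord 11 i (fderiv ℝ φ y (V y)) - dcoord 11 i (fderiv ℝ φ p (V p)) := by
    intro i V hV hi hi4 hV4
    have hGs := h.contDiffAt_fderiv_apply i hV hp
    refine (sub_const_of_fderiv (k := 3) hGs ?_).of_succ
    refine ((hA3.mul_contDiffAt hW (contDiffAt_fderiv (contDiff_legField a 3) hGs)).const_mul hW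
      (-1)).congr ?_
    filter_upwards [hU] with y hy
    -- In the first four coordinates W equals Z_4 = ∂_5 - X_3 Z_3, that is -X_3 Z_3, and X_3
    -- vanishes to order 3.
    have hv : FirstZero 4 (W y + legSlope a 3 y • legField a 3 y) := by
      intro k hk hk4
      rw [map_add, map_smul, hWdef, dcoord_legField_of_le (m := 4) (by omega) ha (by omega) y hk
        (by omega), legField_succ_three ha3, map_sub, map_smul,
        dcoord_basisVec_of_ne hk (by omega) (by omega) (by omega) (by omega)]
      ring
    have h1 := h.fderiv_fderiv_apply hV hy (i := i) (v := W y + legSlope a 3 y • legField a 3 y)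
      fun z hz => h.firstZero (by omega) (by omega) hz hv i hi hi4
    rw [hV4 y _ hv, map_zero, map_zero, map_add, map_smul, smul_eq_mul] at h1
    linarith
  have hfs : ∀ k, ContDiffAt ℝ ∞ (factor φ a b k) p := fun k => h.contDiffAt_factor a b k hp
  have hf94 : ∀ y ∈ φ.source, factor φ a b 9 y = factor φ a b 4 y := by
    intro y hy
    rw [h.factor_succ_of_not (m := 8) (hb 8 (by omega) (by omega)) (ha 8 (by omega) (by omega))
        (by omega) (by omega) hy,
      h.factor_succ_of_not (m := 7) (hb 7 (by omega) (by omega)) (ha 7 (by omega) (by omega))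
        (by omega) (by omega) hy,
      h.factor_succ_of_not (m := 6) (hb 6 (by omega) (by omega)) (ha 6 (by omega) (by omega))
        (by omega) (by omega) hy,
      h.factor_succ_of_not (m := 5) (hb 5 (by omega) (by omega)) (ha 5 (by omega) (by omega))
        (by omega) (by omega) hy,
      h.factor_succ_of_not (m := 4) (hb 4 (by omega) (by omega)) (ha 4 (by omega) (by omega))
        (by omega) (by omega) hy]
  have hf32 : ∀ y ∈ φ.source, factor φ a b 3 y = factor φ a b 2 y := fun y hy =>
    h.factor_succ_of_not hb2 ha2 (by omega) (by omega) hy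
  -- Here f_3 = f_2 is the x¹-component of φ_* Z_2, since the pivot is 1, and Z_2 depends on four
  -- coordinates only.
  have hg : VanishesAlong W p 3 fun y => factor φ a b 3 y - factor φ a b 3 p := by
    refine (hconst 1 (legField a 2) (contDiff_legField a 2) (by omega) (by omega)
      fun y v hv => fderiv_legField_of_firstZero a y hv).congr ?_
    filter_upwards [hU] with y hy
    rw [hf32 y hy, hf32 p hp, factor, factor, hb01]
  have hh := hconst 4 (fun _ => basisVec 11 4) contDiff_const (by omega) (by omega)
    fun y v _ => by simp
  have hf0 : factor φ a b 9 p ≠ 0 := h.factor_ne_zero (by omega) (by omega) hp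
  have hg0 : factor φ a b 3 p ≠ 0 := h.factor_ne_zero (by omega) (by omega) hp
  -- Combines f_4 = g_5 - X_3 dx⁵(φ_* Z_3) with g_4 = f_3 g_5. It makes f_9 constant to order 3,
  -- like f_3, g_4 and 0·X_3.
  have hrel : ∀ y ∈ φ.source, factor φ a b 9 y * factor φ a b 3 y =
      dcoord 11 4 (fderiv ℝ φ y (basisVec 11 4)) -
      legSlope a 3 y * (dcoord 11 5 (fderiv ℝ φ y (legField a 3 y)) * factor φ a b 3 y) := by
    intro y hy
    have e1 := factor_succ_three (φ := φ) (x := y) hb3 ha3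
    have e2 := h.fderiv_basisVec_of_not hb2 ha2 (by omega) (by omega) hy
    simp only [Nat.reduceAdd] at e1 e2
    rw [hf94 y hy, e1, e2]
    ring
  have hf : VanishesAlong W p 3 fun y => factor φ a b 9 y - factor φ a b 9 p := by
    refine of_mul hW (G := factor φ a b 3) (((hh.add (hg.const_mul hW (- factor φ a b 9 p))).add
      ((hA3.mul_contDiffAt hW ((h.contDiffAt_fderiv_apply 5 (contDiff_legField a 3) hp).mul
        (hfs 3))).const_mul hW (-1))).congr ?_) (hfs 3) hg0
    filter_upwards [hU] with y hy
    have e1 := hrel y hy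
    have e2 := hrel p hp
    rw [h3, zero_mul, sub_zero] at e2
    linear_combination e2 - e1
  set c := factor φ a b 9 p with hc
  set κ := factor φ a b 3 p / c with hκ
  -- Order 6 = 3 + 3: X_3 vanishes to order 3, and f_3/f_9 differs from κ to order 3. Five
  -- derivatives then still leave order 1 at the last letter.
  have r3 : VanishesAlong W p 6 fun y => legSlope b 3 (φ y) - κ * legSlope a 3 y := by
    refine of_mul hW (G := fun y => c * factor φ a b 9 y) ((hA3.mul hW ((hg.const_mul hW c).add
      (hf.const_mul hW (- factor φ a b 3 p)))).congr ?_) (contDiffAt_const.mul (hfs 9))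
      (mul_ne_zero hf0 hf0)
    filter_upwards [hU] with y hy
    have e1 := h.legSlope_mul_factor hb3 ha3 (by omega) (by omega) hy
    simp only [Nat.reduceAdd] at e1
    rw [← hf94 y hy] at e1
    rw [hκ]
    field_simp
    linear_combination c * e1
  have step : ∀ m k j : ℕ, ∀ κ' : ℝ, 3 ≤ m → m ≤ 7 →
      VanishesAlong W p (k + 1) (fun y => legSlope b m (φ y) - κ' * legSlope a m y) →
      VanishesAlong W p j (legSlope a (m + 1)) → k ≤ 3 + j →
      VanishesAlong W p k fun y => legSlope b (m + 1) (φ y) - κ' / c * legSlope a (m + 1) y :=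
    fun m k j κ' h1 h2 h3 h4 h5 => proportional_fderiv hW (hfs 9) rfl hf0 hf (hAs m) (hPs m)
      (.of_forall (hAd m h1 h2)) (hPd m h1 h2) h3 h4 h5
  have r4 := step 3 5 2 _ (by omega) (by omega) r3 hA4 (by omega)
  have r5 := step 4 4 1 _ (by omega) (by omega) r4 hA5 (by omega)
  have r6 := step 5 3 0 _ (by omega) (by omega) r5 (hAs 6) (by omega)
  have r7 := step 6 2 0 _ (by omega) (by omega) r6 (hAs 7) (by omega)
  have r8 := step 7 1 0 _ (by omega) (by omega) r7 (hAs 8) (by omega)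
  have e6 := r6.2.1
  have e7 := r7.2.1
  have e8 := r8.2.1
  simp only [Nat.reduceAdd] at e6 e7 e8
  -- The common constants give κ/c³ = 1 and κ/c⁴ = 1, so c = 1.
  rw [h66, sub_eq_zero, eq_comm, mul_eq_right₀ h6] at e6
  rw [e6, h77, sub_eq_zero, eq_comm, mul_eq_right₀ h7] at e7
  rw [e6, e7] at e8
  have hc1 : c = 1 := by
    field_simp at e7
    exact e7.symm
  rw [hc1] at e8
  linarith

end Transforms

theorem not_locallyEquivalentAt_of_modulus_nine (c₉ c₁₀ c₁₁ c₁₁' : ℝ) (h9 : c₉ ≠ 0)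
    (h10 : c₁₀ ≠ 0) (hne : c₁₁ ≠ c₁₁') : ¬ LocallyEquivalentAt
        (pseudoModel [.one, .three, .one, .one, .two c₉, .two c₁₀, .two c₁₁] : CovectorField 11) 0
        (pseudoModel [.one, .three, .one, .one, .two c₉, .two c₁₀, .two c₁₁'] :
          CovectorField 11) 0 := by
  intro h
  simp only [pseudoModel_eq_flagSystem] at h
  obtain ⟨φ, hφ, hp, hq⟩ := exists_transformsCode (n := 11) h
  have hlast : ∀ c : ℝ, ∀ k, 4 ≤ k → k < 9 →
      ¬ (letters [.one, .three, .one, .one, .two c₉, .two c₁₀, .two c] k).IsThree := by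
    intro c k h1 h2
    interval_cases k <;> simp [letters, Tag.IsThree]
  have := hφ.legSlope_one_three_one_one_two_two_two hp
    (by simp [letters, Tag.IsThree]) (by simp [letters, Tag.IsThree]) (hlast _)
    (by simp [letters, Tag.IsThree]) (by simp [letters, Tag.IsThree]) (hlast _)
    (by simp [pivot, letters, Tag.IsThree])
    (by simp [letters, legSlope, coord, Tag.const]) (by simp [letters, legSlope, coord, Tag.const])
    (by simp [letters, legSlope, coord, Tag.const])
    (by simpa [letters, legSlope, coord, Tag.const] using h9)
    (by rw [hq]; simp [letters, legSlope, coord, Tag.const])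
    (by simpa [letters, legSlope, coord, Tag.const] using h10)
    (by rw [hq]; simp [letters, legSlope, coord, Tag.const])
  rw [hq] at this
  simp [letters, legSlope, coord, Tag.const] at this
  exact hne this.symm

/-! ### Uncountable families -/

theorem locallyEquivalentAt_refl {n : ℕ} (S : CovectorField n) (p : Space n) :
    LocallyEquivalentAt S p S p := by
  refine ⟨OpenPartialHomeomorph.refl _, mem_univ _, rfl, contDiffOn_id, contDiffOn_id,
    fun x _ α => ?_⟩
  simp

/-- A family of systems with a real modulus contains uncountably many pairwise inequivalent
members. -/
theorem exists_uncountable_of_modulus {n : ℕ} {P : CovectorField n → Prop}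
    {M : ℝ → CovectorField n} (hP : ∀ c, P (M c))
    (hM : ∀ c c', c ≠ c' → ¬ LocallyEquivalentAt (M c) 0 (M c') 0) :
    ∃ F : Set (CovectorField n), ¬ F.Countable ∧ (∀ S ∈ F, P S) ∧
      F.Pairwise fun S S' => ¬ LocallyEquivalentAt S 0 S' 0 := by
  have hinj : Function.Injective M := fun c c' h => by
    by_contra hne
    exact hM c c' hne (h ▸ locallyEquivalentAt_refl _ _)
  -- The value 0 is left out because a letter 2 carries a non-zero constant.
  refine ⟨M '' {c | c ≠ 0}, fun hc => ?_, ?_, ?_⟩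
  · have h1 : ({c : ℝ | c ≠ 0}).Countable := countable_of_injective_of_countable_image hinj.injOn hc
    refine Cardinal.not_countable_real ((h1.union (countable_singleton (0 : ℝ))).mono ?_)
    intro c _
    rcases eq_or_ne c 0 with rfl | hc
    · exact Or.inr rfl
    · exact Or.inl hc
  · rintro _ ⟨c, -, rfl⟩
    exact hP c
  · rintro _ ⟨c, -, rfl⟩ _ ⟨c', -, rfl⟩ hne
    exact hM c c' fun h => hne (h ▸ rfl)

theorem mainTheorem9 :
    -- (3.2.3.3.2.) and (3.2.3.3.2-.)
    (∀ c₆ c₉ c₉' : ℝ, c₆ ≠ 0 → 0 < c₉ → c₉' < 0 →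
      ¬ LocallyEquivalentAt
        (pseudoModel [.three, .two c₆, .three, .three, .two c₉] : CovectorField 9) 0
        (pseudoModel [.three, .two c₆, .three, .three, .two c₉'] : CovectorField 9) 0) ∧
    -- no local equivalence of the elementary model (3.1.3.3.1.) joins the two points
    (¬ LocallyEquivalentAt
        (pseudoModel [.three, .one, .three, .three, .one] : CovectorField 9)
        ![0, 0, 0, 0, 0, 1, 0, 0, 1]
        (pseudoModel [.three, .one, .three, .three, .one] : CovectorField 9)
        ![0, 0, 0, 0, 0, 1, 0, 0, -1]) ∧
    -- (3.2.3.2.3.2(c).)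
    (∀ c₆ c₈ c₁₀ c₁₀' : ℝ, c₆ ≠ 0 → c₈ ≠ 0 → c₁₀ ≠ 0 → c₁₀' ≠ 0 → c₁₀ ≠ c₁₀' →
      ¬ LocallyEquivalentAt
        (pseudoModel [.three, .two c₆, .three, .two c₈, .three, .two c₁₀] : CovectorField 10) 0
        (pseudoModel [.three, .two c₆, .three, .two c₈, .three, .two c₁₀'] : CovectorField 10)
        0) ∧
    -- (1.3.1.1.2.2.2(c).)
    (∀ c₉ c₁₀ c₁₁ c₁₁' : ℝ, c₉ ≠ 0 → c₁₀ ≠ 0 → c₁₁ ≠ 0 → c₁₁' ≠ 0 → c₁₁ ≠ c₁₁' →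
      ¬ LocallyEquivalentAt
        (pseudoModel [.one, .three, .one, .one, .two c₉, .two c₁₀, .two c₁₁] : CovectorField 11) 0
        (pseudoModel [.one, .three, .one, .one, .two c₉, .two c₁₀, .two c₁₁'] :
          CovectorField 11) 0) ∧
    -- uncountably many non-equivalent flag systems, of length 8 as well as of length 9
    (∀ ℓ ∈ ({8, 9} : Set ℕ), ∃ F : Set (CovectorField (ℓ + 2)), ¬ F.Countable ∧
      (∀ S ∈ F, IsFlagSystem univ ℓ ℓ S) ∧
      F.Pairwise fun S S' => ¬ LocallyEquivalentAt S 0 S' 0) := by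
  refine ⟨not_locallyEquivalentAt_of_sign, not_locallyEquivalentAt_elementary,
    fun c₆ c₈ c₁₀ c₁₀' h6 h8 _ _ => not_locallyEquivalentAt_of_modulus_eight c₆ c₈ c₁₀ c₁₀' h6 h8,
    fun c₉ c₁₀ c₁₁ c₁₁' h9 h10 _ _ =>
      not_locallyEquivalentAt_of_modulus_nine c₉ c₁₀ c₁₁ c₁₁' h9 h10, ?_⟩
  rintro ℓ (rfl | rfl)
  · exact exists_uncountable_of_modulus
      (M := fun c => pseudoModel [.three, .two 1, .three, .two 1, .three, .two c])
      (fun c => by rw [pseudoModel_eq_flagSystem]; exact isFlagSystem_flagSystem _ le_rfl _)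
      fun c c' => not_locallyEquivalentAt_of_modulus_eight 1 1 c c' one_ne_zero one_ne_zero
  · exact exists_uncountable_of_modulus
      (M := fun c => pseudoModel [.one, .three, .one, .one, .two 1, .two 1, .two c])
      (fun c => by rw [pseudoModel_eq_flagSystem]; exact isFlagSystem_flagSystem _ le_rfl _)
      fun c c' => not_locallyEquivalentAt_of_modulus_nine 1 1 c c' one_ne_zero one_ne_zero
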